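/- **Definitions.** A near-unanimity term of arity $n\ge 3$ (an $n$-near-unanimity term) is an $n$-ary term $u$ such that $u(x,\dots,x,y,x,\dots,x)=x$ holds for every position of the single $y$; it is symmetric if it is invariant under all permutations of its arguments. For $n\ge 2$, an $n\frac12$-near-unanimity term is an $(n+2)$-ary term $u$ satisfying $$u(z,z,x,\dots,x)=x,\qquad u(x,\dots,x,\underset{i}{z},x,\dots,x)=x\ \ (2\le i\le n+2),\qquad u(x,x,x,z,\dots,z)=u(x,z,z,z,\dots,z).$$ A variety is $k$-distributive if it has Jónsson terms $t_0,\dots,t_k$, that is, ternary terms with $x=t_0(x,y,z)$, $x=t_i(x,y,x)$ for $0\le i\le k$, $t_i(x,x,z)=t_{i+1}(x,x,z)$ for even $i<k$, $t_i(x,z,z)=t_{i+1}(x,z,z)$ for odd $i<k$, and $t_k(x,y,z)=z$. It is $k$-modular if it has Day terms $t_0,\dots,t_k$, that is, $4$-ary terms with $x=t_i(x,y,y,x)$ for $0\le i\le k$, $x=t_0(x,y,z,w)$, $t_i(x,x,w,w)=t_{i+1}(x,x,w,w)$ for even $i<k$, $t_i(x,y,y,w)=t_{i+1}(x,y,y,w)$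 for odd $i<k$, and $t_k(x,y,z,w)=w$. Consider the extra equations, for an $(n+2)$-ary term $u$, for all $3\le i\le n+2$ and all permutations $\tau$ of $\{3,\dots,n+2\}$: - (uu1) $u(x,z,x,\dots,x,\underset{i}{y},x,\dots,x)=x$; - (uu2) $u(x,y,x_3,x_4,\dots,\underset{i}{x},\dots,x_{n+2})=u(x,z,x_3,x_4,\dots,\underset{i}{x},\dots,x_{n+2})$; - (uu3) $u(x,x,z,\dots,z,\underset{i}{x},z,\dots,z)=u(x,z,z,\dots,z)$; - (uu4) $u(x_1,x_2,x_3,\dots,x_{n+2})=u(x_1,x_2,x_{\tau(3)},\dots,x_{\tau(n+2)})$. For $n\ge3$ let $\mathcal N_{n\frac12}$ be the variety with one $(n+2)$-ary operation that is generated by the following algebras on $\{0,1\}$ (with $+$, juxtaposition and $'$ for join, meet and complement): the algebra with operation $$(x_1+x_2')\prod_{1\le i<j\le n+2,\ i,j\ne 2}(x_i+x_j)$$ and, for each $j$ with $3\le j\le\lfloor (n+2)/2\rfloor$, the algebra with operation $\prod_{|J|=j}\sum_{i\in J}x_i$, where $J$ ranges over the $j$-element subsets of $\{1,3,4,\dots,n+2\}$.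 **Corollary 6.3.** **(A)** Let $S\subseteq\{(uu1),(uu2),(uu3)\}$, and add the equations in $S$ to the definition of an $n\frac12$-near-unanimity term. Then the following hold. For all $h,k\in\mathbb N\cup(\mathbb N+\frac12)$ with $h,k\ge3$: 1. If $h<k$, then every variety with an $h$-near-unanimity term has a $k$-near-unanimity term, and there is a locally finite variety with a $k$-near-unanimity term but without an $h$-near-unanimity term. 2. Every variety with an $h$-near-unanimity term is $(2h-4)$-distributive, and there is a locally finite variety with an $h$-near-unanimity term which is not $(2h-5)$-distributive. 3. Every variety with an $h$-near-unanimity term is $(2h-3)$-modular, and if $h\ge4$ there is a locally finite variety with an $h$-near-unanimity term which is not $(2h-4)$-modular. For every integer $n\ge3$: 1. Every variety with an $n\frac12$-near-unanimity term has an $(n+1)$-ary near-unanimity term. 2. There is a locally finite variety with an $(n+1)$-ary near-unanimity term but without an $n\frac12$-near-unanimity term. 3. Every variety with an $n$-ary near-unanimity term has an $n\frac12$-near-unanimity term. 4. There is a locally finite variety with an $n\frac12$-near-unanimity term but without an $n$-ary near-unanimity term. **(B)** Let $S\subseteq\{(uu1),(uu2),(uu3),(uu4)\}$ and $n\ge3$.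 The variety $\mathcal N_{n\frac12}$ has an $n\frac12$-near-unanimity term satisfying the equations in $S$, and it is not $(2n-4)$-distributive. More generally, the congruence identity $$\alpha(\beta\circ\gamma)\subseteq\alpha\beta\circ(\alpha(\gamma\circ\beta))^{n-3}\circ\alpha\gamma$$ fails in $\mathcal N_{n\frac12}$ (juxtaposition denotes intersection, powers are relational powers, and $R^0$ is the identity relation). **(C)** If a variety has a symmetric $n$-near-unanimity term, then it has an $n\frac12$-near-unanimity term satisfying (uu1)–(uu4). -/

import Mathlib

namespace NearUnanimity

universe u v w

/-- A variety (equational class) of `L`-algebras, given by a set of identities.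
Only languages without relation symbols are used. -/
structure Variety (L : FirstOrder.Language.{u, v}) where
  /-- The defining identities, as pairs of terms in countably many variables. -/
  identities : Set (L.Term ℕ × L.Term ℕ)

/-- The identity `e` holds in the algebra `A`. -/
def HoldsIn {L : FirstOrder.Language.{u, v}} (e : L.Term ℕ × L.Term ℕ) (A : Type w) [L.Structure A] : Prop :=
  ∀ x : ℕ → A, e.1.realize x = e.2.realize x

/-- The algebra `A` belongs to the variety `V`. -/
def Variety.Mem {L : FirstOrder.Language.{u, v}} (V : Variety L) (A : Type w) [L.Structure A] : Prop :=
  ∀ e ∈ V.identities, HoldsIn e A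

/-- The variety generated by a class of algebras: the smallest equational class containing it,
namely the class of models of all the identities valid throughout the class. -/
def Variety.generatedBy {L : FirstOrder.Language.{u, v}}
    (K : Set (CategoryTheory.Bundled.{w} L.Structure)) : Variety L where
  identities := {e | ∀ A ∈ K, HoldsIn e A}

/-- A variety is locally finite if all its finitely generated members are finite.
(Every identity and every finitely generated member is seen in the universe of the language,
since the free algebra on countably many generators lives there.) -/
def Variety.LocallyFinite {L : FirstOrder.Language.{u, v}} (V : Variety L) : Prop :=
  ∀ (A : Type u) [L.Structure A], V.Mem A → FirstOrder.Language.Structure.FG L A → Finite A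

/-- `f` is a near-unanimity operation of arity `n`. -/
def IsNU {A : Type w} (n : ℕ) (f : (Fin n → A) → A) : Prop :=
  ∀ (i : Fin n) (x y : A), f (Function.update (fun _ => x) i y) = x

/-- `f` is invariant under all permutations of its arguments. -/
def IsSymmetric {A : Type w} (n : ℕ) (f : (Fin n → A) → A) : Prop :=
  ∀ (τ : Equiv.Perm (Fin n)) (x : Fin n → A), f (fun i => x (τ i)) = f x

/-- `f` is an `n½`-near-unanimity operation (of arity `n + 2`).  The argument places, which are
numbered `1, …, n + 2` in the usual notation, are numbered `0, …, n + 1` here. -/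
structure IsHalfNU {A : Type w} (n : ℕ) (f : (Fin (n + 2) → A) → A) : Prop where
  /-- `f (z, z, x, …, x) = x` -/
  eq1 : ∀ x z : A, f (fun i => if i.val < 2 then z else x) = x
  /-- `f (x, …, x, z, x, …, x) = x`, with `z` at any place except the first one -/
  eq2 : ∀ (i : Fin (n + 2)) (x z : A), 1 ≤ i.val → f (Function.update (fun _ => x) i z) = x
  /-- `f (x, x, x, z, …, z) = f (x, z, …, z)` -/
  eq3 : ∀ x z : A, f (fun i => if i.val < 3 then x else z) = f (fun i => if i.val < 1 then x else z)

/-- Names for the four extra (families of) equations. -/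
inductive ExtraEqn : Type
  | uu1
  | uu2
  | uu3
  | uu4

/-- The meaning of the four extra (families of) equations, for an operation of arity `n + 2`. -/
def ExtraEqn.Holds {A : Type w} (n : ℕ) (f : (Fin (n + 2) → A) → A) : ExtraEqn → Prop
  -- `f (x, z, x, …, x, y, x, …, x) = x`, with `y` at any place `i` from the third on
  | .uu1 => ∀ (i : Fin (n + 2)) (x y z : A), 2 ≤ i.val →
      f (fun j => if j = i then y else if j.val = 1 then z else x) = x
  -- the second argument is irrelevant if the first one occurs again from the third place on
  | .uu2 => ∀ (i : Fin (n + 2)) (x : Fin (n + 2) → A) (y z : A), 2 ≤ i.val → x i = x 0 →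
      f (Function.update x 1 y) = f (Function.update x 1 z)
  -- `f (x, x, z, …, z, x, z, …, z) = f (x, z, …, z)`, the third `x` at any place from the third on
  | .uu3 => ∀ (i : Fin (n + 2)) (x z : A), 2 ≤ i.val →
      f (fun j => if j.val < 2 ∨ j = i then x else z) = f (fun j => if j.val < 1 then x else z)
  -- invariance under permutations of the places from the third on
  | .uu4 => ∀ τ : Equiv.Perm (Fin (n + 2)), τ 0 = 0 → τ 1 = 1 →
      ∀ x : Fin (n + 2) → A, f (fun i => x (τ i)) = f x

/-- `V` has an `n`-ary near-unanimity term. -/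
def Variety.HasNUTerm {L : FirstOrder.Language.{u, v}} (V : Variety L) (n : ℕ) : Prop :=
  3 ≤ n ∧ ∃ t : L.Term (Fin n), ∀ (A : Type u) [L.Structure A], V.Mem A →
    IsNU n (fun x : Fin n → A => t.realize x)

/-- `V` has a symmetric `n`-ary near-unanimity term. -/
def Variety.HasSymmetricNUTerm {L : FirstOrder.Language.{u, v}} (V : Variety L) (n : ℕ) : Prop :=
  3 ≤ n ∧ ∃ t : L.Term (Fin n), ∀ (A : Type u) [L.Structure A], V.Mem A →
    IsNU n (fun x : Fin n → A => t.realize x) ∧ IsSymmetric n (fun x : Fin n → A => t.realize x)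

/-- `V` has an `n½`-near-unanimity term that satisfies in addition the equations in `S`. -/
def Variety.HasHalfNUTerm {L : FirstOrder.Language.{u, v}} (V : Variety L) (S : Set ExtraEqn) (n : ℕ) :
    Prop :=
  2 ≤ n ∧ ∃ t : L.Term (Fin (n + 2)), ∀ (A : Type u) [L.Structure A], V.Mem A →
    IsHalfNU n (fun x : Fin (n + 2) → A => t.realize x) ∧
      ∀ e ∈ S, ExtraEqn.Holds n (fun x : Fin (n + 2) → A => t.realize x) e

/-- `V` has an `h`-near-unanimity term, where `h = H / 2` is an integer or a half-integer; in the
second case the term is required to satisfy in addition the equations in `S`. -/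
def Variety.HasNU {L : FirstOrder.Language.{u, v}} (V : Variety L) (S : Set ExtraEqn) (H : ℕ) : Prop :=
  (∃ n : ℕ, H = 2 * n ∧ V.HasNUTerm n) ∨ (∃ n : ℕ, H = 2 * n + 1 ∧ V.HasHalfNUTerm S n)

/-- `t 0, …, t k` satisfy Jónsson's equations. -/
structure IsJonsson {A : Type w} (k : ℕ) (t : ℕ → (Fin 3 → A) → A) : Prop where
  first : ∀ x y z : A, x = t 0 ![x, y, z]
  middle : ∀ i ≤ k, ∀ x y : A, x = t i ![x, y, x]
  even : ∀ i < k, Even i → ∀ x z : A, t i ![x, x, z] = t (i + 1) ![x, x, z]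
  odd : ∀ i < k, Odd i → ∀ x z : A, t i ![x, z, z] = t (i + 1) ![x, z, z]
  last : ∀ x y z : A, t k ![x, y, z] = z

/-- `V` is `k`-distributive: it has Jónsson terms `t 0, …, t k`. -/
def Variety.IsDistributive {L : FirstOrder.Language.{u, v}} (V : Variety L) (k : ℕ) : Prop :=
  ∃ t : ℕ → L.Term (Fin 3), ∀ (A : Type u) [L.Structure A], V.Mem A →
    IsJonsson k (fun i (x : Fin 3 → A) => (t i).realize x)

/-- `t 0, …, t k` satisfy Day's equations. -/
structure IsDay {A : Type w} (k : ℕ) (t : ℕ → (Fin 4 → A) → A) : Prop where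
  middle : ∀ i ≤ k, ∀ x y : A, x = t i ![x, y, y, x]
  first : ∀ x y z w : A, x = t 0 ![x, y, z, w]
  even : ∀ i < k, Even i → ∀ x w : A, t i ![x, x, w, w] = t (i + 1) ![x, x, w, w]
  odd : ∀ i < k, Odd i → ∀ x y w : A, t i ![x, y, y, w] = t (i + 1) ![x, y, y, w]
  last : ∀ x y z w : A, t k ![x, y, z, w] = w

/-- `V` is `k`-modular: it has Day terms `t 0, …, t k`. -/
def Variety.IsModular {L : FirstOrder.Language.{u, v}} (V : Variety L) (k : ℕ) : Prop :=
  ∃ t : ℕ → L.Term (Fin 4), ∀ (A : Type u) [L.Structure A], V.Mem A →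
    IsDay k (fun i (x : Fin 4 → A) => (t i).realize x)

/-- The equivalence relation `r` is a congruence of the algebra `A`. -/
def IsCongruence (L : FirstOrder.Language.{u, v}) {A : Type w} [L.Structure A] (r : Setoid A) : Prop :=
  ∀ (n : ℕ) (f : L.Functions n) (x y : Fin n → A), (∀ i, r (x i) (y i)) →
    r (FirstOrder.Language.Structure.funMap f x) (FirstOrder.Language.Structure.funMap f y)

/-- The relational power `R ∘ R ∘ ⋯ ∘ R` with `k` factors; the identity relation for `k = 0`. -/
def relPow {A : Type w} (R : A → A → Prop) : ℕ → A → A → Prop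
  | 0 => Eq
  | k + 1 => Relation.Comp (relPow R k) R

/-- The only operation symbol of the language `opLanguage m`; it has arity `m`. -/
inductive OpSymbol (m : ℕ) : ℕ → Type
  | op : OpSymbol m m

/-- The language with just one operation symbol, of arity `m`. -/
def opLanguage (m : ℕ) : FirstOrder.Language.{0, 0} where
  Functions := OpSymbol m
  Relations := fun _ => Empty

/-- The algebra on `A` whose only operation is `f`. -/
@[reducible] def opStructure {A : Type w} (m : ℕ) (f : (Fin m → A) → A) : (opLanguage m).Structure A where
  funMap := fun {_} s => match s with
    | OpSymbol.op => f
  RelMap := fun {_} s => nomatch s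

/-- The Boolean term operation
`(x₁ + x₂') ∏ {(xᵢ + xⱼ) | 1 ≤ i < j ≤ n + 2, i ≠ 2, j ≠ 2}` (places numbered from `0` here). -/
def booleanOp {B : Type w} [BooleanAlgebra B] (n : ℕ) (x : Fin (n + 2) → B) : B :=
  (x 0 ⊔ (x 1)ᶜ) ⊓
    (Finset.univ.filter fun p : Fin (n + 2) × Fin (n + 2) =>
      p.1 < p.2 ∧ p.1 ≠ 1 ∧ p.2 ≠ 1).inf fun p => x p.1 ⊔ x p.2

/-- The lattice term operation `∏_{|J| = j} ∑_{i ∈ J} xᵢ`, with `J` varying over the `j`-element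
sets of places different from the second one (places numbered from `0` here).  It is used only for
`2 ≤ j ≤ n + 1`, where all sums and products are over nonempty sets. -/
def latticeOp {B : Type w} [DistribLattice B] [BoundedOrder B] (n j : ℕ)
    (x : Fin (n + 2) → B) : B :=
  (Finset.powersetCard j (Finset.univ.erase (1 : Fin (n + 2)))).inf fun J => J.sup x

/-- The algebra `G^{nu,n}`, a term reduct of the two-element Boolean algebra. -/
def algG (n : ℕ) : CategoryTheory.Bundled.{0} (opLanguage (n + 2)).Structure :=
  ⟨Bool, opStructure (n + 2) (booleanOp n)⟩

/-- The algebra `N^{j,m,+}` with `m = n + 1`, a term reduct of the two-element lattice. -/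
def algN (n j : ℕ) : CategoryTheory.Bundled.{0} (opLanguage (n + 2)).Structure :=
  ⟨Bool, opStructure (n + 2) (latticeOp n j)⟩

/-- The variety `𝒩_{n½}`, generated by `G^{nu,n}` and the algebras `N^{j,m,+}` with `m = n + 1` and
`3 ≤ j ≤ ℓ`, where `ℓ = ⌊(m + 1) / 2⌋`.  For `n = 3` there is no such `j`, and `G^{nu,3}` is the only
generator. -/
def varietyN (n : ℕ) : Variety (opLanguage (n + 2)) :=
  Variety.generatedBy (insert (algG n) {A | ∃ j : ℕ, 3 ≤ j ∧ j ≤ (n + 2) / 2 ∧ A = algN n j})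

end NearUnanimity

open NearUnanimity

universe u v

/-! Upper bounds are substitutions into the given term. In an `n`-ary near-unanimity term a block of
`z`'s spreads over the places, each further place passing from `x` through `y` to `z`; this yields
Jónsson terms, and Day terms arise likewise. For `n½` the first two places stay at `x` while the
others are filled from the far end, until `u(x,x,x,z,…,z) = u(x,z,…,z)` permits a jump to the single
extra term `u(x,y,z,…,z)`, which collapses to `z` when `x = y`. Two dummy places lead from `n` to
`n½`, and identifying the first two places leads from `n½` to `n + 1`.

Lower bounds come from two-element algebras whose operations count zeros. If `b` has fewer than `j`
zeros, `c` has at most one, and `b ∧ c ≤ a`, then `a` has fewer than `j + 1` zeros. So tuples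
subject to `high j ∧ alpha ≤ mid (j + 1)` and, on the monotone levels, `low j ≤ mid j ≤ high j` are
closed under the operations (`IsThresholdFamily.isAdmissible`). Jónsson or Day terms give a chain
from `first` to `fourth` with `alpha` constantly `1`, alternately preserving the `mid` and the
`high` coordinates. All `mid` coordinates vanish at the start, and every two steps only the topmost
vanishing level can be lost (`seq_mid_eq_false`), whereas `fourth` has `1` everywhere in `mid`: the
chain must be long.

In the half-integer case one more place is counted, and the relation `top`, which involves `beta`,
keeps the highest level under control in the first round. Separation of the near-unanimity levels
then follows by comparing degrees of distributivity. -/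

namespace NearUnanimity

universe w

/-! ### Jónsson, Day and near-unanimity operations by substitution -/

section Operations

variable {A : Type*} {n : ℕ}

theorem IsNU.eq_of_forall_ne {f : (Fin n → A) → A} (h : IsNU n f) {g : Fin n → A} {x : A}
    (i : Fin n) (hg : ∀ j, j ≠ i → g j = x) : f g = x := by
  have : g = Function.update (fun _ => x) i (g i) := by
    funext j
    by_cases hj : j = i
    · subst hj; simp
    · simp [hj, hg j hj]
  rw [this]
  exact h i x (g i)

theorem IsHalfNU.eq_of_forall_ne {f : (Fin (n + 2) → A) → A} (h : IsHalfNU n f)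
    {g : Fin (n + 2) → A} {x : A} (i : Fin (n + 2)) (hi : 1 ≤ i.val)
    (hg : ∀ j, j ≠ i → g j = x) : f g = x := by
  have : g = Function.update (fun _ => x) i (g i) := by
    funext j
    by_cases hj : j = i
    · subst hj; simp
    · simp [hj, hg j hj]
  rw [this]
  exact h.eq2 i x (g i) hi

/-- The positions of the variables in Jónsson terms built from a near-unanimity term. -/
def jonssonIndex (i r : ℕ) : Fin 3 :=
  if r < i / 2 + 1 then 2 else if r = i / 2 + 1 ∧ Odd i then 1 else 0

/-- The positions of the variables in Day terms built from a near-unanimity term. -/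
def dayIndex (i r : ℕ) : Fin 4 :=
  if r < (i + 1) / 2 then 3 else if r = (i + 1) / 2 then (if Even i then 2 else 1) else 0

theorem jonssonIndex_middle (x y : A) (i r : ℕ) (h : r ≠ i / 2 + 1) :
    ![x, y, x] (jonssonIndex i r) = x := by
  unfold jonssonIndex
  split_ifs <;> simp_all

theorem jonssonIndex_even (x z : A) (i r : ℕ) (hi : Even i) :
    ![x, x, z] (jonssonIndex i r) = ![x, x, z] (jonssonIndex (i + 1) r) := by
  obtain ⟨k, rfl⟩ := hi
  have h1 : (k + k) / 2 = k := by omega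
  have h2 : (k + k + 1) / 2 = k := by omega
  unfold jonssonIndex
  rw [h1, h2]
  split_ifs <;> simp_all

theorem jonssonIndex_odd (x z : A) (i r : ℕ) (hi : Odd i) :
    ![x, z, z] (jonssonIndex i r) = ![x, z, z] (jonssonIndex (i + 1) r) := by
  obtain ⟨k, rfl⟩ := hi
  have h1 : (2 * k + 1) / 2 = k := by omega
  have h2 : (2 * k + 1 + 1) / 2 = k + 1 := by omega
  have h3 : ¬ Odd (2 * k + 1 + 1) := by rw [Nat.not_odd_iff_even]; exact ⟨k + 1, by ring⟩
  have h4 : Odd (2 * k + 1) := ⟨k, rfl⟩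
  unfold jonssonIndex
  rw [h1, h2]
  simp only [h3, h4, and_true, and_false, if_false]
  split_ifs <;> first | rfl | omega

theorem dayIndex_middle (x y : A) (i r : ℕ) (h : r ≠ (i + 1) / 2) :
    ![x, y, y, x] (dayIndex i r) = x := by
  unfold dayIndex
  split_ifs <;> simp_all

theorem dayIndex_even (x w : A) (i r : ℕ) (hi : Even i) :
    ![x, x, w, w] (dayIndex i r) = ![x, x, w, w] (dayIndex (i + 1) r) := by
  have h3 : ¬ Even (i + 1) := by rw [Nat.not_even_iff_odd]; exact hi.add_one
  obtain ⟨k, rfl⟩ := hi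
  have h1 : (k + k + 1) / 2 = k := by omega
  have h2 : (k + k + 1 + 1) / 2 = k + 1 := by omega
  have h4 : Even (k + k) := ⟨k, rfl⟩
  unfold dayIndex
  rw [h1, h2]
  simp only [h3, h4, if_false, if_true]
  split_ifs <;> first | rfl | omega

theorem dayIndex_odd (x y w : A) (i r : ℕ) (hi : Odd i) :
    ![x, y, y, w] (dayIndex i r) = ![x, y, y, w] (dayIndex (i + 1) r) := by
  obtain ⟨k, rfl⟩ := hi
  have h1 : (2 * k + 1 + 1) / 2 = k + 1 := by omega
  have h2 : (2 * k + 1 + 1 + 1) / 2 = k + 1 := by omega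
  unfold dayIndex
  rw [h1, h2]
  split_ifs <;> rfl

/-- The chain starts with `z` at one place and ends with `x` at one place. Each of the `n - 2`
places changed in between costs two steps, from `x` to `y` and from `y` to `z`. -/
theorem IsNU.isJonsson {f : (Fin n → A) → A} (h : IsNU n f) (hn : 3 ≤ n) :
    IsJonsson (2 * n - 4) (fun i v => f (fun p : Fin n => v (jonssonIndex i p))) where
  first x y z := by
    refine (h.eq_of_forall_ne ⟨0, by omega⟩ fun p hp => ?_).symm
    have : (p : ℕ) ≠ 0 := fun h0 => hp (Fin.ext h0)
    simp [jonssonIndex, this]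
  middle i hi x y := by
    refine (h.eq_of_forall_ne ⟨i / 2 + 1, by omega⟩ fun p hp => ?_).symm
    exact jonssonIndex_middle x y i p fun h0 => hp (Fin.ext h0)
  even i _ he x z := by
    simp only [jonssonIndex_even x z i _ he]
  odd i _ he x z := by
    simp only [jonssonIndex_odd x z i _ he]
  last x y z := by
    refine h.eq_of_forall_ne ⟨n - 1, by omega⟩ fun p hp => ?_
    have h1 : (p : ℕ) ≠ n - 1 := fun h0 => hp (Fin.ext h0)
    have h2 : (p : ℕ) < (2 * n - 4) / 2 + 1 := by have := p.2; omega
    simp [jonssonIndex, h2]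

/-- The place number `(i + 1) / 2` is the only one carrying a middle variable, `z` for even `i` and
`y` for odd `i`. An even step completes one place and opens the next. -/
theorem IsNU.isDay {f : (Fin n → A) → A} (h : IsNU n f) (hn : 3 ≤ n) :
    IsDay (2 * n - 3) (fun i v => f (fun p : Fin n => v (dayIndex i p))) where
  first x y z w := by
    refine (h.eq_of_forall_ne ⟨0, by omega⟩ fun p hp => ?_).symm
    have : (p : ℕ) ≠ 0 := fun h0 => hp (Fin.ext h0)
    simp [dayIndex, this]
  middle i hi x y := by
    refine (h.eq_of_forall_ne ⟨(i + 1) / 2, by omega⟩ fun p hp => ?_).symm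
    exact dayIndex_middle x y i p fun h0 => hp (Fin.ext h0)
  even i _ he x z := by
    simp only [dayIndex_even x z i _ he]
  odd i _ he x y w := by
    simp only [dayIndex_odd x y w i _ he]
  last x y z w := by
    refine h.eq_of_forall_ne ⟨n - 1, by omega⟩ fun p hp => ?_
    have h1 : (p : ℕ) ≠ n - 1 := fun h0 => hp (Fin.ext h0)
    have h2 : (p : ℕ) < (2 * n - 3 + 1) / 2 := by have := p.2; omega
    simp [dayIndex, h2]

/-- The positions of the variables in Jónsson terms built from an `n½`-near-unanimity term. -/
def halfJonssonIndex (n i p : ℕ) : Fin 3 :=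
  if i < 2 * n - 4 then (if p < 2 then 0 else jonssonIndex i (n + 1 - p))
  else if p < 1 then 0 else if p < 2 then 1 else 2

/-- The positions of the variables in Day terms built from an `n½`-near-unanimity term. -/
def halfDayIndex (n i p : ℕ) : Fin 4 :=
  if i < 2 * n - 3 then (if p < 2 then 0 else dayIndex i (n + 1 - p))
  else if p < 1 then 1 else if p < 2 then 2 else 3

/-- The terms below `2 * n - 4` are those of the `n`-ary case read from the last place backwards,
with `x` at the first two places. The remaining nontrivial term is `f (x, y, z, …, z)`. -/
theorem IsHalfNU.isJonsson {f : (Fin (n + 2) → A) → A} (h : IsHalfNU n f) (hn : 3 ≤ n) :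
    IsJonsson (2 * n - 3) (fun i v =>
      if i < 2 * n - 3 then f (fun p : Fin (n + 2) => v (halfJonssonIndex n i p)) else v 2) where
  first x y z := by
    rw [if_pos (by omega)]
    refine (h.eq_of_forall_ne ⟨n + 1, by omega⟩ (by simp) fun p hp => ?_).symm
    have h1 : (p : ℕ) ≠ n + 1 := fun h0 => hp (Fin.ext h0)
    have h2 : n + 1 - (p : ℕ) ≠ 0 := by have := p.2; omega
    have h3 : 0 < 2 * n - 4 := by omega
    simp [halfJonssonIndex, jonssonIndex, h3, h2]
  middle i hi x y := by
    split_ifs with h0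
    · by_cases h1 : i < 2 * n - 4
      · refine (h.eq_of_forall_ne ⟨n + 1 - (i / 2 + 1), by omega⟩
          (by simp only; omega) fun p hp => ?_).symm
        have h3 : (p : ℕ) ≠ n + 1 - (i / 2 + 1) := fun h0 => hp (Fin.ext h0)
        simp only [halfJonssonIndex, if_pos h1]
        split_ifs
        · rfl
        · exact jonssonIndex_middle x y _ _ (by have := p.2; omega)
      · refine (h.eq_of_forall_ne ⟨1, by omega⟩ le_rfl fun p hp => ?_).symm
        have h3 : (p : ℕ) ≠ 1 := fun h0 => hp (Fin.ext h0)
        simp only [halfJonssonIndex, if_neg h1]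
        split_ifs <;> first | rfl | omega
    · rfl
  even i hi he x z := by
    rw [if_pos (by omega)]
    by_cases h1 : i < 2 * n - 4
    · have h2 : i + 1 < 2 * n - 4 := by obtain ⟨k, rfl⟩ := he; omega
      rw [if_pos (by omega)]
      congr 1
      funext p
      simp only [halfJonssonIndex, if_pos h1, if_pos h2]
      split_ifs
      · rfl
      · exact jonssonIndex_even x z _ _ he
    · rw [if_neg (by omega)]
      refine Eq.trans ?_ (h.eq1 z x)
      congr 1
      funext p
      simp only [halfJonssonIndex, if_neg h1]
      split_ifs <;> first | rfl | omega
  odd i hi ho x z := by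
    have h1 : i + 1 < 2 * n - 3 := by obtain ⟨k, rfl⟩ := ho; omega
    rw [if_pos (by omega), if_pos h1]
    by_cases h2 : i + 1 < 2 * n - 4
    · congr 1
      funext p
      simp only [halfJonssonIndex, if_pos h2, if_pos (show i < 2 * n - 4 by omega)]
      split_ifs
      · rfl
      · exact jonssonIndex_odd x z _ _ ho
    -- The jump: at `y = z` the old term is `f (x, x, x, z, …, z)` and the new one `f (x, z, …, z)`.
    · have h3 := h.eq3 x z
      refine Eq.trans (Eq.trans ?_ h3) ?_ <;> congr 1 <;> funext p <;> have hp := p.2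
      · simp only [halfJonssonIndex, if_pos (show i < 2 * n - 4 by omega)]
        rw [apply_ite ![x, z, z], jonssonIndex_odd x z _ _ ho]
        unfold jonssonIndex
        have h5 : (i + 1) / 2 = n - 2 := by omega
        have h4 : ¬ Odd (i + 1) := by rw [Nat.not_odd_iff_even]; exact ho.add_one
        simp only [h4, and_false, if_false, h5]
        split_ifs <;> first | rfl | omega
      · simp only [halfJonssonIndex, if_neg h2]
        split_ifs <;> rfl
  last x y z := by simp

/-- Here the extra term is `f (y, z, w, …, w)`. The equation `eq1` serves twice, for the middle
condition and for the final passage to `w`. -/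
theorem IsHalfNU.isDay {f : (Fin (n + 2) → A) → A} (h : IsHalfNU n f) (hn : 3 ≤ n) :
    IsDay (2 * n - 2) (fun i v =>
      if i < 2 * n - 2 then f (fun p : Fin (n + 2) => v (halfDayIndex n i p)) else v 3) where
  first x y z w := by
    rw [if_pos (by omega)]
    refine (h.eq_of_forall_ne ⟨n + 1, by omega⟩ (by simp) fun p hp => ?_).symm
    have h1 : (p : ℕ) ≠ n + 1 := fun h0 => hp (Fin.ext h0)
    have h2 : n + 1 - (p : ℕ) ≠ 0 := by have := p.2; omega
    have h3 : 0 < 2 * n - 3 := by omega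
    simp [halfDayIndex, dayIndex, h3, h2]
  middle i hi x y := by
    split_ifs with h0
    · by_cases h1 : i < 2 * n - 3
      · refine (h.eq_of_forall_ne ⟨n + 1 - (i + 1) / 2, by omega⟩
          (by simp only; omega) fun p hp => ?_).symm
        have h3 : (p : ℕ) ≠ n + 1 - (i + 1) / 2 := fun h0 => hp (Fin.ext h0)
        simp only [halfDayIndex, if_pos h1]
        split_ifs
        · rfl
        · exact dayIndex_middle x y _ _ (by have := p.2; omega)
      · refine (Eq.trans ?_ (h.eq1 x y)).symm
        congr 1
        funext p
        simp only [halfDayIndex, if_neg h1]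
        split_ifs <;> first | rfl | omega
    · rfl
  even i hi he x w := by
    have h1 : i + 1 < 2 * n - 2 := by obtain ⟨k, rfl⟩ := he; omega
    rw [if_pos (by omega), if_pos h1]
    by_cases h2 : i + 1 < 2 * n - 3
    · congr 1
      funext p
      simp only [halfDayIndex, if_pos h2, if_pos (show i < 2 * n - 3 by omega)]
      split_ifs
      · rfl
      · exact dayIndex_even x w _ _ he
    · have h3 := h.eq3 x w
      refine Eq.trans (Eq.trans ?_ h3) ?_ <;> congr 1 <;> funext p <;> have hp := p.2
      · simp only [halfDayIndex, if_pos (show i < 2 * n - 3 by omega)]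
        unfold dayIndex
        have h5 : (i + 1) / 2 = n - 2 := by obtain ⟨k, rfl⟩ := he; omega
        simp only [he, if_true, h5]
        split_ifs <;> first | rfl | omega
      · simp only [halfDayIndex, if_neg h2]
        split_ifs <;> rfl
  odd i hi ho x y w := by
    rw [if_pos (by omega)]
    by_cases h1 : i < 2 * n - 3
    · have h2 : i + 1 < 2 * n - 3 := by obtain ⟨k, rfl⟩ := ho; omega
      rw [if_pos (by omega)]
      congr 1
      funext p
      simp only [halfDayIndex, if_pos h1, if_pos h2]
      split_ifs
      · rfl
      · exact dayIndex_odd x y w _ _ ho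
    · rw [if_neg (by omega)]
      refine Eq.trans ?_ (h.eq1 w y)
      congr 1
      funext p
      simp only [halfDayIndex, if_neg h1]
      split_ifs <;> first | rfl | omega
  last x y z w := by simp

/-- Truncated subtraction identifies the first two places; `eq1` covers the merged place and `eq2`
all others. -/
theorem IsHalfNU.isNU {f : (Fin (n + 2) → A) → A} (h : IsHalfNU n f) :
    IsNU (n + 1) (fun v => f (fun p => v ⟨p.val - 1, by omega⟩)) := by
  intro i x y
  by_cases hi : i.val = 0
  · refine Eq.trans ?_ (h.eq1 x y)
    refine congrArg f (funext fun p => ?_)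
    have h0 : (⟨p.val - 1, by omega⟩ : Fin (n + 1)) = i ↔ p.val < 2 := by
      rw [Fin.ext_iff]; simp only; omega
    simp only [Function.update_apply, h0]
  · refine h.eq_of_forall_ne i.succ (by simp) fun p hp => ?_
    have h1 : p.val ≠ i.val + 1 := fun h0 => hp (Fin.ext h0)
    have h0 : (⟨p.val - 1, by omega⟩ : Fin (n + 1)) ≠ i := by
      rw [Ne, Fin.ext_iff]; simp only; omega
    simp [h0]

variable {f : (Fin n → A) → A}

/-- The first two places are dummies, so both sides of `eq3` reduce to `z`. -/
theorem IsNU.isHalfNU (h : IsNU n f) (hn : 3 ≤ n) :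
    IsHalfNU n (fun v => f (fun p => v p.succ.succ)) where
  eq1 x z := h.eq_of_forall_ne ⟨0, by omega⟩ fun p _ => by simp
  eq2 i x z hi := by
    by_cases h1 : i.val = 1
    · refine h.eq_of_forall_ne ⟨0, by omega⟩ fun p _ => ?_
      have : p.succ.succ ≠ i := by rw [Ne, Fin.ext_iff]; simp; omega
      simp [this]
    · refine h.eq_of_forall_ne ⟨i.val - 2, by omega⟩ fun p hp => ?_
      have h2 : p.val ≠ i.val - 2 := fun h0 => hp (Fin.ext h0)
      have : p.succ.succ ≠ i := by rw [Ne, Fin.ext_iff]; simp; omega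
      simp [this]
  eq3 x z := by
    refine Eq.trans (b := z) (h.eq_of_forall_ne ⟨0, by omega⟩ fun p hp => ?_)
      (h.eq_of_forall_ne ⟨0, by omega⟩ fun p _ => by simp).symm
    have h2 : p.val ≠ 0 := fun h0 => hp (Fin.ext h0)
    have h3 : ¬ p.val + 1 + 1 < 3 := by omega
    simp [h3]

theorem IsNU.extraEqn_holds (h : IsNU n f) (hn : 3 ≤ n) {e : ExtraEqn} (he : e ≠ .uu4) :
    e.Holds n (fun v => f (fun p => v p.succ.succ)) := by
  cases e with
  | uu1 =>
    intro i x y z hi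
    refine h.eq_of_forall_ne ⟨i.val - 2, by omega⟩ fun p hp => ?_
    have h2 : p.val ≠ i.val - 2 := fun h0 => hp (Fin.ext h0)
    have : p.succ.succ ≠ i := by rw [Ne, Fin.ext_iff]; simp; omega
    simp [this]
  | uu2 =>
    intro i x y z _ _
    have (p : Fin n) : p.succ.succ ≠ (1 : Fin (n + 2)) := by simp [Fin.ext_iff]
    simp [this]
  | uu3 =>
    intro i x z hi
    refine Eq.trans (b := z) (h.eq_of_forall_ne ⟨i.val - 2, by omega⟩ fun p hp => ?_)
      (h.eq_of_forall_ne ⟨0, by omega⟩ fun p _ => by simp).symm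
    have h2 : p.val ≠ i.val - 2 := fun h0 => hp (Fin.ext h0)
    have : p.succ.succ ≠ i := by rw [Ne, Fin.ext_iff]; simp; omega
    simp [this]
  | uu4 => exact absurd rfl he

theorem IsSymmetric.extraEqn_holds (h : IsSymmetric n f) :
    ExtraEqn.uu4.Holds n (fun v => f (fun p => v p.succ.succ)) := by
  intro τ h0 h1 x
  have key (i : Fin (n + 2)) : 2 ≤ i.val ↔ i ≠ 0 ∧ i ≠ 1 := by
    simp only [Ne, Fin.ext_iff, Fin.val_zero, Fin.val_one]; omega
  have hτ (i : Fin (n + 2)) (hi : 2 ≤ i.val) : 2 ≤ (τ i).val := by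
    rw [key] at hi ⊢
    refine ⟨fun h => hi.1 ?_, fun h => hi.2 ?_⟩
    · exact τ.injective (h.trans h0.symm)
    · exact τ.injective (h.trans h1.symm)
  let g (p : Fin n) : Fin n := ⟨(τ p.succ.succ).val - 2, by have := p.2; omega⟩
  have hg (p : Fin n) : (g p).succ.succ = τ p.succ.succ := by
    have := hτ p.succ.succ (by simp)
    rw [Fin.ext_iff]; simp only [g, Fin.val_succ]; omega
  have hinj : Function.Injective g := by
    intro p q hpq
    have : τ p.succ.succ = τ q.succ.succ := by rw [← hg, ← hg, hpq]
    simpa using τ.injective this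
  have := h (Equiv.ofBijective g (Finite.injective_iff_bijective.1 hinj)) (fun p => x p.succ.succ)
  simpa [hg] using this

end Operations

/-! ### Passage from operations to terms of a variety -/

section Terms

variable {L : FirstOrder.Language.{u, v}} {V : Variety L} {S : Set ExtraEqn} {n : ℕ}

theorem Variety.HasNUTerm.isDistributive (h : V.HasNUTerm n) : V.IsDistributive (2 * n - 4) := by
  obtain ⟨hn, t, ht⟩ := h
  refine ⟨fun i => t.relabel fun p : Fin n => jonssonIndex i p, fun A _ hA => ?_⟩
  simpa [FirstOrder.Language.Term.realize_relabel, Function.comp_def] using (ht A hA).isJonsson hn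

theorem Variety.HasNUTerm.isModular (h : V.HasNUTerm n) : V.IsModular (2 * n - 3) := by
  obtain ⟨hn, t, ht⟩ := h
  refine ⟨fun i => t.relabel fun p : Fin n => dayIndex i p, fun A _ hA => ?_⟩
  simpa [FirstOrder.Language.Term.realize_relabel, Function.comp_def] using (ht A hA).isDay hn

theorem Variety.HasHalfNUTerm.isDistributive (h : V.HasHalfNUTerm S n) (hn : 3 ≤ n) :
    V.IsDistributive (2 * n - 3) := by
  obtain ⟨-, t, ht⟩ := h
  refine ⟨fun i => if i < 2 * n - 3 then
    t.relabel fun p : Fin (n + 2) => halfJonssonIndex n i p else FirstOrder.Language.var 2, fun A _ hA => ?_⟩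
  convert (ht A hA).1.isJonsson hn using 3 with i v
  by_cases hi : i < 2 * n - 3 <;>
    simp [hi, FirstOrder.Language.Term.realize_relabel, Function.comp_def]

theorem Variety.HasHalfNUTerm.isModular (h : V.HasHalfNUTerm S n) (hn : 3 ≤ n) :
    V.IsModular (2 * n - 2) := by
  obtain ⟨-, t, ht⟩ := h
  refine ⟨fun i => if i < 2 * n - 2 then
    t.relabel fun p : Fin (n + 2) => halfDayIndex n i p else FirstOrder.Language.var 3, fun A _ hA => ?_⟩
  convert (ht A hA).1.isDay hn using 3 with i v
  by_cases hi : i < 2 * n - 2 <;>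
    simp [hi, FirstOrder.Language.Term.realize_relabel, Function.comp_def]

theorem Variety.HasHalfNUTerm.hasNUTerm (h : V.HasHalfNUTerm S n) : V.HasNUTerm (n + 1) := by
  obtain ⟨hn, t, ht⟩ := h
  refine ⟨by omega, t.relabel fun p => ⟨p.val - 1, by omega⟩, fun A _ hA => ?_⟩
  simpa [FirstOrder.Language.Term.realize_relabel, Function.comp_def] using (ht A hA).1.isNU

theorem Variety.HasNUTerm.hasHalfNUTerm (h : V.HasNUTerm n)
    (hS : S ⊆ {ExtraEqn.uu1, ExtraEqn.uu2, ExtraEqn.uu3}) : V.HasHalfNUTerm S n := by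
  obtain ⟨hn, t, ht⟩ := h
  refine ⟨by omega, t.relabel fun p => p.succ.succ, fun A _ hA => ⟨?_, fun e he => ?_⟩⟩
  · simpa only [FirstOrder.Language.Term.realize_relabel, Function.comp_def] using (ht A hA).isHalfNU hn
  · simp only [FirstOrder.Language.Term.realize_relabel, Function.comp_def]
    refine (ht A hA).extraEqn_holds hn ?_
    rintro rfl
    simpa using hS he

theorem Variety.HasSymmetricNUTerm.hasHalfNUTerm (h : V.HasSymmetricNUTerm n) :
    V.HasHalfNUTerm Set.univ n := by
  obtain ⟨hn, t, ht⟩ := h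
  refine ⟨by omega, t.relabel fun p => p.succ.succ, fun A _ hA => ⟨?_, fun e _ => ?_⟩⟩
  · simpa only [FirstOrder.Language.Term.realize_relabel, Function.comp_def] using (ht A hA).1.isHalfNU hn
  · simp only [FirstOrder.Language.Term.realize_relabel, Function.comp_def]
    by_cases he : e = .uu4
    · subst he
      exact (ht A hA).2.extraEqn_holds
    · exact (ht A hA).1.extraEqn_holds hn he

theorem Variety.HasNU.succ {H : ℕ} (hS : S ⊆ {ExtraEqn.uu1, ExtraEqn.uu2, ExtraEqn.uu3})
    (h : V.HasNU S H) : V.HasNU S (H + 1) := by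
  rcases h with ⟨n, rfl, h⟩ | ⟨n, rfl, h⟩
  · exact .inr ⟨n, rfl, h.hasHalfNUTerm hS⟩
  · exact .inl ⟨n + 1, by ring, h.hasNUTerm⟩

theorem Variety.HasNU.mono {H K : ℕ} (hS : S ⊆ {ExtraEqn.uu1, ExtraEqn.uu2, ExtraEqn.uu3})
    (h : V.HasNU S H) (hHK : H ≤ K) : V.HasNU S K := by
  induction K, hHK using Nat.le_induction with
  | base => exact h
  | succ K _ ih => exact ih.succ hS

theorem Variety.HasNU.isDistributive {H : ℕ} (hH : 6 ≤ H) (h : V.HasNU S H) :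
    V.IsDistributive (H - 4) := by
  rcases h with ⟨n, rfl, h⟩ | ⟨n, rfl, h⟩
  · exact h.isDistributive
  · exact h.isDistributive (by omega)

theorem Variety.HasNU.isModular {H : ℕ} (hH : 6 ≤ H) (h : V.HasNU S H) :
    V.IsModular (H - 3) := by
  rcases h with ⟨n, rfl, h⟩ | ⟨n, rfl, h⟩
  · exact h.isModular
  · exact h.isModular (by omega)

end Terms

/-! ### Identities, local finiteness, and congruence chains -/

section General

variable {L : FirstOrder.Language.{u, v}}

open FirstOrder.Language FirstOrder.Language.Structure

theorem realize_comp {A : Type*} {B : Type*} [L.Structure A] [L.Structure B] {φ : A → B}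
    (hφ : ∀ (n : ℕ) (f : L.Functions n) (x : Fin n → A),
      φ (funMap f x) = funMap f fun i => φ (x i)) {ι : Type*} (t : L.Term ι) (x : ι → A) :
    φ (t.realize x) = t.realize fun i => φ (x i) := by
  induction t with
  | var i => rfl
  | func f ts ih => simp only [Term.realize_func, hφ, ih]

theorem holdsIn_of_separating {A : Type*} [L.Structure A] {e : L.Term ℕ × L.Term ℕ}
    {ι : Type*} (B : ι → Type*) (I : ∀ i, L.Structure (B i)) (φ : ∀ i, A → B i)
    (hφ : ∀ i (n : ℕ) (f : L.Functions n) (x : Fin n → A),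
      φ i (funMap f x) = funMap f fun j => φ i (x j))
    (hsep : ∀ a b : A, (∀ i, φ i a = φ i b) → a = b) (he : ∀ i, HoldsIn e (B i)) :
    HoldsIn e A := by
  intro x
  refine hsep _ _ fun i => ?_
  rw [realize_comp (hφ i), realize_comp (hφ i)]
  exact he i _

/-- An element is the value of a term at the finitely many generators, and it is determined by the
functions which this term induces on the finitely many finite algebras in `K`. -/
theorem Variety.generatedBy_locallyFinite {K : Set (CategoryTheory.Bundled.{w} L.Structure)}
    (hK : K.Finite) (hfin : ∀ A ∈ K, Finite A) : (Variety.generatedBy K).LocallyFinite := by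
  intro A _ hA hfg
  obtain ⟨S, hS, hcl⟩ := fg_iff.1 hfg
  have := hK.to_subtype
  have := hS.to_subtype
  have (G : K) : Finite (G : CategoryTheory.Bundled L.Structure) := hfin G G.2
  obtain ⟨g, hg⟩ := Countable.exists_injective_nat S
  have hex (a : A) : ∃ t : L.Term S, t.realize ((↑) : S → A) = a := by
    rw [← FirstOrder.Language.Substructure.mem_closure_iff_exists_term, hcl]; trivial
  choose t ht using hex
  let Φ (a : A) (G : K) (x : S → (G : CategoryTheory.Bundled L.Structure)) :
      (G : CategoryTheory.Bundled L.Structure) :=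
    letI := (G : CategoryTheory.Bundled L.Structure).str
    (t a).realize x
  refine Finite.of_injective Φ fun a b hab => ?_
  -- Terms inducing the same functions on all of `K` form an identity, once the generators are
  -- numbered by `g`.
  have hmem : ((t a).relabel g, (t b).relabel g) ∈ (Variety.generatedBy K).identities := by
    intro G hG x
    simp only [Term.realize_relabel]
    exact congrFun (congrFun hab ⟨G, hG⟩) (x ∘ g)
  rcases isEmpty_or_nonempty S with hempty | ⟨⟨s⟩⟩
  · have hx := hA _ hmem (fun _ => a)
    simp only [Term.realize_relabel] at hx
    rw [← ht a, ← ht b]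
    convert hx using 2
  · have : Nonempty S := ⟨s⟩
    have hx := hA _ hmem (fun i => (Function.invFun g i : S))
    simp only [Term.realize_relabel, Function.comp_def, Function.leftInverse_invFun hg _] at hx
    rw [← ht a, ← ht b]
    exact hx

theorem IsCongruence.realize {A : Type*} [L.Structure A] {r : Setoid A} (h : IsCongruence L r)
    {ι : Type*} (t : L.Term ι) {x y : ι → A} (hxy : ∀ i, r (x i) (y i)) :
    r (t.realize x) (t.realize y) := by
  induction t with
  | var i => exact hxy i
  | func f ts ih => exact h _ _ _ _ ih

/-- The chain is `t i (a, b, c)`: it stays in the `α`-class of `a` since `t i (a, b, a) = a`, and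
consecutive members are linked by replacing `b` with `a` or with `c`. -/
theorem Variety.IsDistributive.exists_seq {V : Variety L} {k : ℕ} (h : V.IsDistributive k)
    {A : Type u} [L.Structure A] (hA : V.Mem A) {α β γ : Setoid A} (hα : IsCongruence L α)
    (hβ : IsCongruence L β) (hγ : IsCongruence L γ) {a b c : A} (hac : α a c) (hab : β a b)
    (hbc : γ b c) :
    ∃ s : ℕ → A, s 0 = a ∧ s k = c ∧ (∀ i ≤ k, α a (s i)) ∧
      (∀ i < k, Even i → β (s i) (s (i + 1))) ∧ (∀ i < k, Odd i → γ (s i) (s (i + 1))) := by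
  obtain ⟨t, ht⟩ := h
  have ht := ht A hA
  have hr {r : Setoid A} (hr : IsCongruence L r) (i : ℕ) {x₀ x₁ x₂ y₀ y₁ y₂ : A}
      (h0 : r x₀ y₀) (h1 : r x₁ y₁) (h2 : r x₂ y₂) :
      r ((t i).realize ![x₀, x₁, x₂]) ((t i).realize ![y₀, y₁, y₂]) :=
    hr.realize _ fun j => by fin_cases j <;> assumption
  refine ⟨fun i => (t i).realize ![a, b, c], (ht.first a b c).symm, ht.last a b c,
    fun i hi => ?_, fun i hi he => ?_, fun i hi ho => ?_⟩
  · have h1 := hr hα i (α.refl a) (α.refl b) hac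
    have h2 := ht.middle i hi a b
    rwa [← h2] at h1
  · have h1 := hr hβ i (β.refl a) (β.symm hab) (β.refl c)
    have h2 := hr hβ (i + 1) (β.refl a) hab (β.refl c)
    have h3 := ht.even i hi he a c
    rw [← h3] at h2
    exact β.trans h1 h2
  · have h1 := hr hγ i (γ.refl a) hbc (γ.refl c)
    have h2 := hr hγ (i + 1) (γ.refl a) (γ.symm hbc) (γ.refl c)
    have h3 := ht.odd i hi ho a c
    rw [← h3] at h2
    exact γ.trans h1 h2

theorem Variety.IsModular.exists_seq {V : Variety L} {k : ℕ} (h : V.IsModular k)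
    {A : Type u} [L.Structure A] (hA : V.Mem A) {α β γ : Setoid A} (hα : IsCongruence L α)
    (hβ : IsCongruence L β) (hγ : IsCongruence L γ) {a b c d : A} (had : α a d) (hab : β a b)
    (hbc : γ b c) (hbc' : α b c) (hcd : β c d) :
    ∃ s : ℕ → A, s 0 = a ∧ s k = d ∧ (∀ i ≤ k, α a (s i)) ∧
      (∀ i < k, Even i → β (s i) (s (i + 1))) ∧ (∀ i < k, Odd i → γ (s i) (s (i + 1))) := by
  obtain ⟨t, ht⟩ := h
  have ht := ht A hA
  have hr {r : Setoid A} (hr : IsCongruence L r) (i : ℕ) {x₀ x₁ x₂ x₃ y₀ y₁ y₂ y₃ : A}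
      (h0 : r x₀ y₀) (h1 : r x₁ y₁) (h2 : r x₂ y₂) (h3 : r x₃ y₃) :
      r ((t i).realize ![x₀, x₁, x₂, x₃]) ((t i).realize ![y₀, y₁, y₂, y₃]) :=
    hr.realize _ fun j => by fin_cases j <;> assumption
  refine ⟨fun i => (t i).realize ![a, b, c, d], (ht.first a b c d).symm, ht.last a b c d,
    fun i hi => ?_, fun i hi he => ?_, fun i hi ho => ?_⟩
  · have h1 := hr hα i (α.refl a) (α.refl b) hbc' had
    have h2 := ht.middle i hi a b
    rwa [← h2] at h1
  · have h1 := hr hβ i (β.refl a) (β.symm hab) hcd (β.refl d)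
    have h2 := hr hβ (i + 1) (β.refl a) hab (β.symm hcd) (β.refl d)
    have h3 := ht.even i hi he a d
    rw [← h3] at h2
    exact β.trans h1 h2
  · have h1 := hr hγ i (γ.refl a) (γ.refl b) (γ.symm hbc) (γ.refl d)
    have h2 := hr hγ (i + 1) (γ.refl a) (γ.refl b) hbc (γ.refl d)
    have h3 := ht.odd i hi ho a b d
    rw [← h3] at h2
    exact γ.trans h1 h2

end General

/-! ### Boolean operations described by counting zeros -/

section BooleanOperations

variable {m : ℕ}

/-- The number of places in `P` at which `x` vanishes. -/
def zeros (P : Finset (Fin m)) (x : Fin m → Bool) : ℕ := (P.filter fun i => x i = false).card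

/-- The operation whose value is `1` when there are fewer than `j` zeros at the places in `P`. -/
def thresholdOp (P : Finset (Fin m)) (j : ℕ) (x : Fin m → Bool) : Bool := decide (zeros P x < j)

variable {P T : Finset (Fin m)} {a b c x : Fin m → Bool}

theorem zeros_le (h : ∀ i ∈ P, x i = false → i ∈ T) : zeros P x ≤ T.card :=
  Finset.card_le_card fun i hi => by
    rw [Finset.mem_filter] at hi
    exact h i hi.1 hi.2

theorem le_zeros (hT : T ⊆ P) (h : ∀ i ∈ T, x i = false) : T.card ≤ zeros P x :=
  Finset.card_le_card fun i hi => Finset.mem_filter.2 ⟨hT hi, h i hi⟩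

theorem zeros_anti (h : ∀ i, a i = true → b i = true) : zeros P b ≤ zeros P a := by
  refine zeros_le fun i hi hb => Finset.mem_filter.2 ⟨hi, ?_⟩
  by_contra ha
  simp [h i (by simpa using ha)] at hb

theorem zeros_le_add (h : ∀ i, b i = true → c i = true → a i = true) :
    zeros P a ≤ zeros P b + zeros P c := by
  refine (zeros_le (T := (P.filter fun i => b i = false) ∪ P.filter fun i => c i = false)
    fun i hi ha => ?_).trans (Finset.card_union_le _ _)
  simp only [Finset.mem_union, Finset.mem_filter]
  have := h i
  rw [ha] at this
  cases hb : b i <;> cases hc : c i <;> simp_all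

theorem card_le_zeros_add (h : ∀ i, ¬ (a i = true ∧ b i = true ∧ c i = true)) :
    P.card ≤ zeros P a + zeros P b + zeros P c := by
  have h1 : P ⊆ ((P.filter fun i => a i = false) ∪ P.filter fun i => b i = false) ∪
      P.filter fun i => c i = false := by
    intro i hi
    simp only [Finset.mem_union, Finset.mem_filter]
    have := h i
    cases ha : a i <;> cases hb : b i <;> cases hc : c i <;> simp_all
  exact (Finset.card_le_card h1).trans ((Finset.card_union_le _ _).trans
    (Nat.add_le_add_right (Finset.card_union_le _ _) _))

theorem zeros_not_add_zeros : zeros P (fun i => !x i) + zeros P x = P.card := by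
  unfold zeros
  rw [← Finset.card_filter_add_card_filter_not (s := P) (fun i => x i = true)]
  simp

/-- At least `j` zeros means at most `P.card - j` ones, which are the zeros of the complement. -/
theorem thresholdOp_not {j j' : ℕ} (h : j + j' = P.card + 1) :
    (!thresholdOp P j x) = thresholdOp P j' fun i => !x i := by
  have := zeros_not_add_zeros (P := P) (x := x)
  unfold thresholdOp
  rw [Bool.eq_iff_iff]
  simp
  omega

/-- The places of an `(n + 2)`-ary operation other than the second one. -/
abbrev places (n : ℕ) : Finset (Fin (n + 2)) := Finset.univ.erase 1

theorem card_places (n : ℕ) : (places n).card = n + 1 := by simp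

/-- The product vanishes exactly when some `j`-element set of places consists of zeros. -/
theorem latticeOp_eq {n j : ℕ} : latticeOp (B := Bool) n j = thresholdOp (places n) j := by
  funext x
  rw [Bool.eq_iff_iff]
  simp only [latticeOp, thresholdOp, decide_eq_true_eq]
  change _ = (⊤ : Bool) ↔ _
  rw [eq_top_iff, Finset.le_inf_iff]
  constructor
  · intro h
    by_contra! hj
    obtain ⟨J, hJ, hcard⟩ := Finset.exists_subset_card_eq hj
    have h1 := h J (Finset.mem_powersetCard.2 ⟨hJ.trans (Finset.filter_subset _ _), hcard⟩)
    have h2 : J.sup x ≤ ⊥ := Finset.sup_le fun i hi => by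
      rw [(Finset.mem_filter.1 (hJ hi)).2]; exact bot_le
    exact absurd (h1.trans h2) (by decide)
  · intro h J hJ
    rw [Finset.mem_powersetCard] at hJ
    by_contra hx
    have h1 : J.card ≤ zeros (places n) x := le_zeros hJ.1 fun i hi => by
      by_contra hi'
      have h2 : x i = ⊤ := by simpa using hi'
      exact hx (h2 ▸ Finset.le_sup (f := x) hi)
    omega

theorem booleanOp_eq_true_iff {n : ℕ} {x : Fin (n + 2) → Bool} :
    booleanOp n x = true ↔ zeros (places n) x < 2 ∧ (x 0 = true ∨ x 1 = false) := by
  have h1 : (x 0 ⊔ (x 1)ᶜ = ⊤) ↔ (x 0 = true ∨ x 1 = false) := by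
    cases x 0 <;> cases x 1 <;> decide
  change _ = (⊤ : Bool) ↔ _
  rw [booleanOp, inf_eq_top_iff, h1, and_comm]
  refine and_congr_left fun _ => ?_
  rw [Nat.lt_succ_iff, zeros, Finset.card_le_one, eq_top_iff, Finset.le_inf_iff]
  simp only [Finset.mem_filter, Finset.mem_erase, Finset.mem_univ, and_true, true_and, Prod.forall]
  have key (p q : Fin (n + 2)) : (⊤ ≤ x p ⊔ x q) ↔ ¬ (x p = false ∧ x q = false) := by
    cases x p <;> cases x q <;> decide
  simp only [key]
  constructor
  · rintro h p ⟨hp1, hp⟩ q ⟨hq1, hq⟩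
    by_contra hpq
    rcases lt_or_gt_of_ne hpq with hlt | hlt
    · exact h p q ⟨hlt, hp1, hq1⟩ ⟨hp, hq⟩
    · exact h q p ⟨hlt, hq1, hp1⟩ ⟨hq, hp⟩
  · rintro h p q ⟨hlt, hp1, hq1⟩ ⟨hp, hq⟩
    exact hlt.ne (h p ⟨hp1, hp⟩ q ⟨hq1, hq⟩)

theorem isNU_thresholdOp {n j : ℕ} (h2 : 2 ≤ j) (hj : j + 1 ≤ n) :
    IsNU n (thresholdOp (Finset.univ : Finset (Fin n)) j) := by
  intro i x y
  unfold thresholdOp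
  cases x
  · have := le_zeros (P := Finset.univ) (x := Function.update (fun _ => false) i y)
      (T := Finset.univ.erase i) (Finset.subset_univ _) fun k hk => by
        simp [Finset.ne_of_mem_erase hk]
    rw [Finset.card_erase_of_mem (Finset.mem_univ _), Finset.card_univ, Fintype.card_fin] at this
    simp; omega
  · have := zeros_le (P := Finset.univ) (x := Function.update (fun _ => true) i y)
      (T := {i}) fun k _ hk => by
        by_contra h
        simp [Finset.mem_singleton.not.1 h] at hk
    rw [Finset.card_singleton] at this
    simp; omega

variable {n j : ℕ} {f : (Fin (n + 2) → Bool) → Bool}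

/-- The operations that generate `𝒩_{n½}`, described by the number of zeros. -/
def IsCountingOp (n j : ℕ) (f : (Fin (n + 2) → Bool) → Bool) : Prop :=
  2 ≤ j ∧ j + 1 ≤ n ∧
    ∀ x, f x = true ↔ zeros (places n) x < j ∧ (j = 2 → x 0 = true ∨ x 1 = false)

theorem IsCountingOp.eq_of_forall (hf : IsCountingOp n j f) (i : Fin (n + 2)) (hi : i ≠ 1)
    {x : Fin (n + 2) → Bool} {b : Bool} (hx : ∀ k, k ≠ 1 → k ≠ i → x k = b)
    (h0 : x 0 = true ∨ x 1 = false ∨ b = false) : f x = b := by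
  obtain ⟨h2, hj, hf⟩ := hf
  cases b
  · have h1 := le_zeros (P := places n) (x := x) (T := (places n).erase i)
      (Finset.erase_subset _ _) fun k hk => by
        simp only [Finset.mem_erase] at hk
        exact hx k hk.2.1 hk.1
    rw [Finset.card_erase_of_mem (by simp [hi]), card_places] at h1
    rw [← Bool.not_eq_true, hf]
    omega
  · have h1 := zeros_le (P := places n) (x := x) (T := {i}) fun k hk hk' => by
      by_contra h
      rw [hx k (Finset.ne_of_mem_erase hk) (Finset.mem_singleton.not.1 h)] at hk'
      exact absurd hk' (by simp)
    rw [Finset.card_singleton] at h1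
    rw [hf]
    refine ⟨by omega, fun _ => ?_⟩
    simpa using h0

theorem fin_eq_one_iff (i : Fin (n + 2)) : i = 1 ↔ i.val = 1 := by
  rw [Fin.ext_iff, Fin.val_one]

theorem fin_eq_zero_iff (i : Fin (n + 2)) : i = 0 ↔ i.val = 0 := by
  rw [Fin.ext_iff, Fin.val_zero]

theorem IsCountingOp.uu1 (hf : IsCountingOp n j f) : ExtraEqn.uu1.Holds n f := by
  intro i x y z hi
  have h1 : i ≠ 1 := by rw [Ne, fin_eq_one_iff]; omega
  have h0 : (0 : Fin (n + 2)) ≠ i := by rw [ne_comm, Ne, fin_eq_zero_iff]; omega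
  refine hf.eq_of_forall i h1 (fun k hk1 hki => ?_) ?_
  · rw [Ne, fin_eq_one_iff] at hk1
    simp [hki, hk1]
  · cases x <;> simp [h0]

/-- The second argument matters only for `j = 2` and `x 0 = 0`; but then `x i = 0` provides a second
zero and the value is `0` anyway. -/
theorem IsCountingOp.uu2 (hf : IsCountingOp n j f) : ExtraEqn.uu2.Holds n f := by
  obtain ⟨-, -, hf⟩ := hf
  intro i x y z hi h0
  have h1 : i ≠ 1 := by rw [Ne, fin_eq_one_iff]; omega
  have h2 : i ≠ 0 := by rw [Ne, fin_eq_zero_iff]; omega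
  have hz (y : Bool) : zeros (places n) (Function.update x 1 y) = zeros (places n) x := by
    unfold zeros
    congr 1
    refine Finset.filter_congr fun k hk => ?_
    rw [Function.update_of_ne (Finset.ne_of_mem_erase hk)]
  rw [Bool.eq_iff_iff, hf, hf, hz, hz]
  refine and_congr_right fun hlt => forall_congr' fun hj => ?_
  have hx0 : x 0 = true := by
    by_contra hx
    rw [Bool.not_eq_true] at hx
    have := le_zeros (P := places n) (x := x) (T := {0, i})
      (fun k hk => by
        simp only [Finset.mem_insert, Finset.mem_singleton] at hk
        rcases hk with rfl | rfl <;> simp [h1])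
      (fun k hk => by
        simp only [Finset.mem_insert, Finset.mem_singleton] at hk
        rcases hk with rfl | rfl <;> simp [h0, hx])
    rw [Finset.card_pair h2.symm] at this
    omega
  simp [hx0]

/-- For `x = 0` there are two zeros against one, which differ only for threshold `2`; there the
factor `x₁ + x₂'` makes the right side `0` as well. For `x = 1` both sides have at least `n - 1 ≥ j`
zeros. -/
theorem IsCountingOp.uu3 (hf : IsCountingOp n j f) : ExtraEqn.uu3.Holds n f := by
  obtain ⟨h2, hj, hf⟩ := hf
  intro i x z hi
  have h1 : i ≠ 1 := by rw [Ne, fin_eq_one_iff]; omega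
  have h0 : i ≠ 0 := by rw [Ne, fin_eq_zero_iff]; omega
  by_cases hxz : x = z
  · simp [hxz]
  obtain rfl : z = !x := by cases x <;> cases z <;> simp_all
  have hT : ({0, i} : Finset (Fin (n + 2))) ⊆ places n := fun k hk => by
    simp only [Finset.mem_insert, Finset.mem_singleton] at hk
    rcases hk with rfl | rfl <;> simp [h1]
  have hT' : ({0} : Finset (Fin (n + 2))) ⊆ places n := fun k hk => by
    rw [Finset.mem_singleton.1 hk]; simp
  have hcard := Finset.card_pair h0.symm
  rw [Bool.eq_iff_iff, hf, hf]
  cases x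
  · have e1 := le_zeros (x := fun k => if k.val < 2 ∨ k = i then false else !false) hT
      fun k hk => by
        simp only [Finset.mem_insert, Finset.mem_singleton] at hk
        rcases hk with rfl | rfl <;> simp
    have e2 := zeros_le (P := places n) (T := {0, i})
      (x := fun k => if k.val < 2 ∨ k = i then false else !false) fun k hk hk' => by
        have h3 := Finset.ne_of_mem_erase hk
        simp only [Finset.mem_insert, Finset.mem_singleton, fin_eq_zero_iff k]
        rw [Ne, fin_eq_one_iff] at h3
        by_contra h4
        rw [if_neg (by omega)] at hk'
        simp at hk'
    have e3 := zeros_le (P := places n) (T := {0})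
      (x := fun k => if k.val < 1 then false else !false) fun k hk hk' => by
        simp only [Finset.mem_singleton, fin_eq_zero_iff k]
        by_contra h4
        rw [if_neg (by omega)] at hk'
        simp at hk'
    rw [hcard] at e1 e2
    rw [Finset.card_singleton] at e3
    have e4 : (1 : Fin (n + 2)).val = 1 := Fin.val_one _
    simp only [Fin.val_zero, e4, Nat.lt_irrefl, zero_lt_one, if_true, if_false, true_or,
      Nat.one_lt_two, Nat.zero_lt_two, Bool.not_false, Bool.false_eq_true, reduceCtorEq, or_true,
      or_false, imp_false] at e1 e2 e3 ⊢
    omega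
  · have e1 := le_zeros (x := fun k => if k.val < 2 ∨ k = i then true else !true)
      (T := (places n) \ {0, i}) Finset.sdiff_subset fun k hk => by
        simp only [Finset.mem_sdiff, Finset.mem_insert, Finset.mem_singleton,
          fin_eq_zero_iff k] at hk
        have h3 := Finset.ne_of_mem_erase hk.1
        rw [Ne, fin_eq_one_iff] at h3
        rw [if_neg (by omega)]
        simp
    have e2 := le_zeros (x := fun k => if k.val < 1 then true else !true)
      (T := (places n) \ {0}) Finset.sdiff_subset fun k hk => by
        simp only [Finset.mem_sdiff, Finset.mem_singleton, fin_eq_zero_iff k] at hk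
        rw [if_neg (by omega)]
        simp
    rw [Finset.card_sdiff_of_subset hT, hcard, card_places] at e1
    rw [Finset.card_sdiff_of_subset hT', Finset.card_singleton, card_places] at e2
    omega

theorem IsCountingOp.uu4 (hf : IsCountingOp n j f) : ExtraEqn.uu4.Holds n f := by
  obtain ⟨-, -, hf⟩ := hf
  intro τ h0 h1 x
  have hz : zeros (places n) (fun i => x (τ i)) = zeros (places n) x := by
    unfold zeros
    refine Finset.card_equiv τ fun i => ?_
    have : τ i = 1 ↔ i = 1 := by
      conv_lhs => rw [← h1]
      exact τ.injective.eq_iff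
    simp [this]
  rw [Bool.eq_iff_iff, hf, hf, hz, h0, h1]

theorem IsCountingOp.extraEqn_holds (hf : IsCountingOp n j f) (e : ExtraEqn) : e.Holds n f := by
  cases e
  exacts [hf.uu1, hf.uu2, hf.uu3, hf.uu4]

theorem IsCountingOp.isHalfNU (hf : IsCountingOp n j f) : IsHalfNU n f where
  eq1 x z := by
    refine hf.eq_of_forall 0 (by simp) (fun k hk1 hk0 => ?_) ?_
    · rw [Ne, fin_eq_one_iff] at hk1
      rw [Ne, fin_eq_zero_iff] at hk0
      rw [if_neg (by omega)]
    · cases z <;> simp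
  eq2 i x z hi := by
    by_cases h1 : i = 1
    · subst h1
      refine hf.eq_of_forall 0 (by simp) (fun k hk1 _ => by simp [hk1]) ?_
      cases x <;> simp
    · refine hf.eq_of_forall i h1 (fun k _ hki => by simp [hki]) ?_
      have h0 : (0 : Fin (n + 2)) ≠ i := by rw [ne_comm, Ne, fin_eq_zero_iff]; omega
      cases x <;> simp [h0]
  eq3 x z := by
    have hn : 2 < n + 2 := by have := hf.1; have := hf.2.1; omega
    refine Eq.trans (congrArg f (funext fun k => ?_)) (hf.uu3 ⟨2, hn⟩ x z le_rfl)
    have : (k.val < 3) ↔ (k.val < 2 ∨ k = ⟨2, hn⟩) := by rw [Fin.ext_iff]; simp only; omega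
    simp only [this]

theorem isCountingOp_booleanOp (hn : 3 ≤ n) : IsCountingOp n 2 (booleanOp n) :=
  ⟨le_rfl, hn, fun x => by rw [booleanOp_eq_true_iff]; simp⟩

theorem isCountingOp_latticeOp (hj : 3 ≤ j) (hj' : j ≤ (n + 2) / 2) :
    IsCountingOp n j (latticeOp n j) :=
  ⟨by omega, by omega, fun x => by
    rw [latticeOp_eq, thresholdOp, decide_eq_true_eq]
    exact ⟨fun h => ⟨h, fun h' => by omega⟩, fun h => h.1⟩⟩

end BooleanOperations

open FirstOrder.Language FirstOrder.Language.Structure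

instance (m : ℕ) : (opLanguage m).IsAlgebraic := fun _ => inferInstanceAs (IsEmpty Empty)

/-! ### Varieties generated by algebras on `{0, 1}` -/

section BoolVariety

variable {m : ℕ}

/-- The variety generated by the algebras on `{0, 1}` whose operations are the members of `F`. -/
def boolVariety (F : Set ((Fin m → Bool) → Bool)) : Variety (opLanguage m) :=
  Variety.generatedBy ((fun f => ⟨Bool, opStructure m f⟩) '' F)

/-- The identity `e` holds in the algebra on `{0, 1}` with the operation `f`. -/
def HoldsFor (f : (Fin m → Bool) → Bool) (e : (opLanguage m).Term ℕ × (opLanguage m).Term ℕ) :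
    Prop :=
  letI := opStructure m f
  HoldsIn e Bool

variable {F : Set ((Fin m → Bool) → Bool)}

theorem mem_boolVariety_identities {e : (opLanguage m).Term ℕ × (opLanguage m).Term ℕ} :
    e ∈ (boolVariety F).identities ↔ ∀ f ∈ F, HoldsFor f e := by
  constructor
  · intro h f hf
    exact h _ ⟨f, hf, rfl⟩
  · rintro h _ ⟨f, hf, rfl⟩
    exact h f hf

theorem boolVariety_locallyFinite : (boolVariety F).LocallyFinite := by
  refine Variety.generatedBy_locallyFinite (F.toFinite.image _) ?_
  rintro _ ⟨f, -, rfl⟩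
  exact inferInstanceAs (Finite Bool)

/-- The basic operation as a term. -/
def opTerm {ι : Type*} (σ : Fin m → ι) : (opLanguage m).Term ι :=
  func (L := opLanguage m) OpSymbol.op fun i => var (σ i)

/-- The basic operation of an algebra. -/
def opFun (A : Type*) [(opLanguage m).Structure A] (x : Fin m → A) : A :=
  funMap (L := opLanguage m) OpSymbol.op x

variable {A : Type} [(opLanguage m).Structure A]

theorem opFun_eq_opFun (hA : (boolVariety F).Mem A) (σ τ : Fin m → ℕ)
    (h : ∀ f ∈ F, ∀ x : ℕ → Bool, f (fun i => x (σ i)) = f (fun i => x (τ i))) (x : ℕ → A) :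
    opFun A (fun i => x (σ i)) = opFun A fun i => x (τ i) :=
  hA (opTerm σ, opTerm τ) (mem_boolVariety_identities.2 h) x

theorem opFun_eq_var (hA : (boolVariety F).Mem A) (σ : Fin m → ℕ) (k : ℕ)
    (h : ∀ f ∈ F, ∀ x : ℕ → Bool, f (fun i => x (σ i)) = x k) (x : ℕ → A) :
    opFun A (fun i => x (σ i)) = x k :=
  hA (opTerm σ, var k) (mem_boolVariety_identities.2 h) x

theorem boolVariety_hasNUTerm (hm : 3 ≤ m) (hF : ∀ f ∈ F, IsNU m f) :
    (boolVariety F).HasNUTerm m := by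
  refine ⟨hm, opTerm id, fun A _ hA i x y => ?_⟩
  have key {B : Type} (v : ℕ → B) : (fun p => v (if p = i then 1 else 0)) =
      Function.update (fun _ => v 0) i (v 1) := by
    funext p; rw [Function.update_apply]; split_ifs <;> rfl
  have h := fun v : ℕ → A => opFun_eq_var hA (fun p => if p = i then 1 else 0) 0
    (fun f hf v => by rw [key]; exact hF f hf i _ _) v
  simp only [key] at h
  exact h (fun k => if k = 0 then x else y)

end BoolVariety

/-! ### Transfer of the half-integer equations to the whole variety -/

section Half

variable {n : ℕ} {F : Set ((Fin (n + 2) → Bool) → Bool)} {A : Type}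
  [(opLanguage (n + 2)).Structure A]

theorem isHalfNU_opFun (hA : (boolVariety F).Mem A) (hF : ∀ f ∈ F, IsHalfNU n f) :
    IsHalfNU n (opFun (m := n + 2) A) where
  eq1 x z := by
    have key {B : Type} (v : ℕ → B) : (fun p : Fin (n + 2) => v (if p.val < 2 then 1 else 0)) =
        fun p => if p.val < 2 then v 1 else v 0 := by funext p; split_ifs <;> rfl
    have h := fun v : ℕ → A => opFun_eq_var hA (fun p => if p.val < 2 then 1 else 0) 0
      (fun f hf v => by rw [key]; exact (hF f hf).eq1 _ _) v
    simp only [key] at h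
    exact h (fun k => if k = 0 then x else z)
  eq2 i x z hi := by
    have key {B : Type} (v : ℕ → B) : (fun p => v (if p = i then 1 else 0)) =
        Function.update (fun _ => v 0) i (v 1) := by
      funext p; rw [Function.update_apply]; split_ifs <;> rfl
    have h := fun v : ℕ → A => opFun_eq_var hA (fun p => if p = i then 1 else 0) 0
      (fun f hf v => by rw [key]; exact (hF f hf).eq2 i _ _ hi) v
    simp only [key] at h
    exact h (fun k => if k = 0 then x else z)
  eq3 x z := by
    have key {B : Type} (v : ℕ → B) (r : ℕ) :
        (fun p : Fin (n + 2) => v (if p.val < r then 0 else 1)) =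
        fun p => if p.val < r then v 0 else v 1 := by funext p; split_ifs <;> rfl
    have h := fun v : ℕ → A => opFun_eq_opFun hA (fun p => if p.val < 3 then 0 else 1)
      (fun p => if p.val < 1 then 0 else 1)
      (fun f hf v => by rw [key, key]; exact (hF f hf).eq3 _ _) v
    simp only [key] at h
    exact h (fun k => if k = 0 then x else z)

theorem extraEqn_holds_opFun (hA : (boolVariety F).Mem A) (e : ExtraEqn)
    (hF : ∀ f ∈ F, e.Holds n f) : e.Holds n (opFun (m := n + 2) A) := by
  cases e with
  | uu1 =>
    intro i x y z hi
    have key {B : Type} (v : ℕ → B) :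
        (fun p : Fin (n + 2) => v (if p = i then 1 else if p.val = 1 then 2 else 0)) =
        fun p => if p = i then v 1 else if p.val = 1 then v 2 else v 0 := by
      funext p; split_ifs <;> rfl
    have h := fun v : ℕ → A => opFun_eq_var hA (fun p => if p = i then 1 else if p.val = 1 then 2 else 0) 0
      (fun f hf v => by rw [key]; exact hF f hf i _ _ _ hi) v
    simp only [key] at h
    exact h (fun k => if k = 0 then x else if k = 1 then y else z)
  | uu2 =>
    intro i x y z hi hx
    have key {B : Type} (v : ℕ → B) (r : ℕ) :
        (fun p : Fin (n + 2) => v (if p = 1 then r else if p = i then 0 else p.val)) =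
        Function.update (fun p : Fin (n + 2) => v (if p = i then 0 else p.val)) 1 (v r) := by
      funext p; rw [Function.update_apply]; split_ifs <;> rfl
    -- Variables `n + 2` and `n + 3` are fresh and stand for `y` and `z`; giving place `i` the
    -- variable `0` encodes `x i = x 0`.
    have h := fun v : ℕ → A => opFun_eq_opFun hA (fun p => if p = 1 then n + 2 else if p = i then 0 else p.val)
      (fun p => if p = 1 then n + 3 else if p = i then 0 else p.val)
      (fun f hf v => by
        rw [key, key]
        refine hF f hf i _ _ _ hi ?_
        simp) v
    simp only [key] at h
    have := h fun k => if hk : k < n + 2 then x ⟨k, hk⟩ else if k = n + 2 then y else z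
    simp only [lt_irrefl, dite_false, if_true, show ¬ n + 3 < n + 2 by omega,
      show n + 3 ≠ n + 2 by omega, if_false] at this
    convert this using 3 <;>
    · funext p
      by_cases h1 : p = i
      · subst h1; simp [hx]
      · simp [h1]
  | uu3 =>
    intro i x z hi
    have key {B : Type} (v : ℕ → B) (q : Fin (n + 2) → Prop) [DecidablePred q] :
        (fun p => v (if q p then 0 else 1)) =
        fun p => if q p then v 0 else v 1 := by funext p; split_ifs <;> rfl
    have h := fun v : ℕ → A => opFun_eq_opFun hA (fun p => if p.val < 2 ∨ p = i then 0 else 1)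
      (fun p => if p.val < 1 then 0 else 1)
      (fun f hf v => by
        rw [key v fun p => p.val < 2 ∨ p = i, key v fun p => p.val < 1]
        exact hF f hf i _ _ hi) v
    rw [forall_congr' fun v => by rw [key v fun p => p.val < 2 ∨ p = i, key v fun p => p.val < 1]] at h
    exact h (fun k => if k = 0 then x else z)
  | uu4 =>
    intro τ h0 h1 x
    have := opFun_eq_opFun hA (fun p => (τ p).val) (fun p => p.val)
      (fun f hf v => hF f hf τ h0 h1 fun p => v p.val)
      (fun k => if hk : k < n + 2 then x ⟨k, hk⟩ else x 0)
    simpa using this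

theorem boolVariety_hasHalfNUTerm (hn : 2 ≤ n) (hF : ∀ f ∈ F, ∃ j, IsCountingOp n j f)
    (S : Set ExtraEqn) : (boolVariety F).HasHalfNUTerm S n := by
  refine ⟨hn, opTerm id, fun A _ hA => ⟨isHalfNU_opFun hA fun f hf => ?_, fun e _ =>
    extraEqn_holds_opFun hA e fun f hf => ?_⟩⟩
  · obtain ⟨j, hj⟩ := hF f hf
    exact hj.isHalfNU
  · obtain ⟨j, hj⟩ := hF f hf
    exact hj.extraEqn_holds e

end Half

/-- The generating operations of `𝒩_{n½}`. -/
def halfOps (n : ℕ) : Set ((Fin (n + 2) → Bool) → Bool) :=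
  insert (booleanOp n) {f | ∃ j : ℕ, 3 ≤ j ∧ j ≤ (n + 2) / 2 ∧ f = latticeOp n j}

theorem varietyN_eq (n : ℕ) : varietyN n = boolVariety (halfOps n) := by
  unfold varietyN boolVariety halfOps
  congr 1
  rw [Set.image_insert_eq]
  congr 1
  ext A
  constructor
  · rintro ⟨j, h1, h2, rfl⟩
    exact ⟨_, ⟨j, h1, h2, rfl⟩, rfl⟩
  · rintro ⟨_, ⟨j, h1, h2, rfl⟩, rfl⟩
    exact ⟨j, h1, h2, rfl⟩

theorem varietyN_hasHalfNUTerm {n : ℕ} (hn : 3 ≤ n) (S : Set ExtraEqn) :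
    (varietyN n).HasHalfNUTerm S n := by
  rw [varietyN_eq]
  refine boolVariety_hasHalfNUTerm (by omega) ?_ S
  rintro f (rfl | ⟨j, h1, h2, rfl⟩)
  · exact ⟨2, isCountingOp_booleanOp hn⟩
  · exact ⟨j, isCountingOp_latticeOp h1 h2⟩

/-- Complementation is an isomorphism between the two algebras. -/
theorem HoldsFor.of_not {m : ℕ} {f g : (Fin m → Bool) → Bool}
    (h : ∀ x, (!g x) = f fun i => !x i) {e : (opLanguage m).Term ℕ × (opLanguage m).Term ℕ}
    (he : HoldsFor f e) : HoldsFor g e := by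
  let := opStructure m g
  refine holdsIn_of_separating (fun _ : Unit => Bool) (fun _ => opStructure m f) (fun _ => not) ?_ ?_ fun _ => he
  · rintro - _ ⟨⟩ x
    exact h x
  · intro a b hab
    simpa using hab ()

/-! ### The subalgebra of admissible tuples and the descent along chains -/

section Block

/-- The coordinates of the elements of a block. -/
inductive Coord : Type
  | alpha
  | beta
  | low (j : ℕ)
  | mid (j : ℕ)
  | high (j : ℕ)

/-- The level of the operation by which a coordinate is acted upon. -/
def Coord.level : Coord → ℕ
  | .alpha => 2
  | .beta => 2
  | .low j => j
  | .mid j => j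
  | .high j => j

/-- The relations between the coordinates of the elements of a block. -/
structure IsAdmissible (M l u : ℕ) (v : Coord → Bool) : Prop where
  low_le_mid : ∀ j, l ≤ j → j ≤ u → v (.low j) = true → v (.mid j) = true
  mid_le_high : ∀ j, l ≤ j → j ≤ u → v (.mid j) = true → v (.high j) = true
  high_le : ∀ j, 2 ≤ j → j < u → v (.high j) = true → v .alpha = true → v (.mid (j + 1)) = true
  mid_le : ∀ j, 2 ≤ j → j < u → v (.mid j) = true → v .alpha = true → v (.low (j + 1)) = true
  top : u + 2 ≤ M → ¬ (v (.high u) = true ∧ v .beta = true ∧ v .alpha = true)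

/-- The subalgebra of a power of `{0, 1}` given by the admissible tuples. -/
abbrev Block (M l u : ℕ) : Type := {v : Coord → Bool // IsAdmissible M l u v}

/-- The operations `F j` are close to threshold operations; exactly so for `l ≤ j`. -/
structure IsThresholdFamily {m : ℕ} (P : Finset (Fin m)) (l u : ℕ)
    (F : ℕ → (Fin m → Bool) → Bool) : Prop where
  two_le : 2 ≤ l
  le_three : l ≤ 3
  le_top : 2 ≤ u
  lt : ∀ j, 2 ≤ j → j ≤ u → ∀ x, F j x = true → zeros P x < j
  eq_true : ∀ j, l ≤ j → j ≤ u → ∀ x, zeros P x < j → F j x = true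

variable {m : ℕ} {P : Finset (Fin m)} {l u : ℕ} {F : ℕ → (Fin m → Bool) → Bool}

theorem IsThresholdFamily.mono (hF : IsThresholdFamily P l u F) {j : ℕ} (hl : l ≤ j) (hu : j ≤ u)
    {a b : Fin m → Bool} (h : ∀ i, a i = true → b i = true) (ha : F j a = true) :
    F j b = true :=
  hF.eq_true j hl hu b
    ((zeros_anti h).trans_lt (hF.lt j (hF.two_le.trans hl) hu a ha))

/-- At levels `j` and `2` only the upper bound on zeros is used, so `j = 2` is allowed even when `F
2` is not a threshold operation. -/
theorem IsThresholdFamily.succ (hF : IsThresholdFamily P l u F) {j : ℕ} (h2 : 2 ≤ j) (hu : j < u)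
    {a b c : Fin m → Bool} (h : ∀ i, b i = true → c i = true → a i = true)
    (hb : F j b = true) (hc : F 2 c = true) : F (j + 1) a = true := by
  have h3 := hF.le_three
  have hb' := hF.lt j h2 hu.le b hb
  have hc' := hF.lt 2 le_rfl hF.le_top c hc
  have := zeros_le_add (P := P) h
  exact hF.eq_true (j + 1) (by omega) hu a (by omega)

theorem IsThresholdFamily.isAdmissible (hF : IsThresholdFamily P l u F)
    (x : Fin m → Block P.card l u) :
    IsAdmissible P.card l u fun κ => F κ.level fun i => (x i).1 κ where
  low_le_mid j hl hu := hF.mono hl hu fun i => (x i).2.low_le_mid j hl hu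
  mid_le_high j hl hu := hF.mono hl hu fun i => (x i).2.mid_le_high j hl hu
  high_le j h2 hu := hF.succ h2 hu fun i => (x i).2.high_le j h2 hu
  mid_le j h2 hu := hF.succ h2 hu fun i => (x i).2.mid_le j h2 hu
  top hM := by
    rintro ⟨ha, hb, hc⟩
    have ha' := hF.lt u hF.le_top le_rfl _ ha
    have hb' := hF.lt 2 le_rfl hF.le_top _ hb
    have hc' := hF.lt 2 le_rfl hF.le_top _ hc
    have := card_le_zeros_add (P := P) fun i => (x i).2.top hM
    -- At most `(u - 1) + 1 + 1` places carry a zero, fewer than `P.card`, so some place would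
    -- violate `top`.
    omega

/-- The algebra structure on a block. -/
@[reducible] def blockStructure (hF : IsThresholdFamily P l u F) :
    (opLanguage m).Structure (Block P.card l u) :=
  opStructure m fun x => ⟨_, hF.isAdmissible x⟩

/-- The tuples that agree at all coordinates in `T`. -/
def agree {M l u : ℕ} (T : Set Coord) : Setoid (Block M l u) where
  r v w := ∀ κ ∈ T, v.1 κ = w.1 κ
  iseqv := ⟨fun _ _ _ => rfl, fun h κ hκ => (h κ hκ).symm,
    fun h h' κ hκ => (h κ hκ).trans (h' κ hκ)⟩

theorem isCongruence_agree (hF : IsThresholdFamily P l u F) (T : Set Coord) :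
    letI := blockStructure hF
    IsCongruence (opLanguage m) (agree (M := P.card) (l := l) (u := u) T) := by
  rintro _ ⟨⟩ x y h κ hκ
  exact congrArg (F κ.level) (funext fun i => h i κ hκ)

theorem mem_block (hF : IsThresholdFamily P l u F) {V : Variety (opLanguage m)}
    (hV : ∀ j, ∀ e ∈ V.identities, HoldsFor (F j) e) :
    letI := blockStructure hF
    V.Mem (Block P.card l u) := by
  let := blockStructure hF
  intro e he
  refine holdsIn_of_separating (fun _ : Coord => Bool) (fun κ => opStructure m (F κ.level)) (fun κ v => v.1 κ) ?_ ?_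
    fun κ => hV κ.level e he
  · rintro κ _ ⟨⟩ x
    rfl
  · exact fun a b h => Subtype.ext (funext h)

/-- The tuple with the given entries. -/
def tuple (a b lo mi hi : Bool) : Coord → Bool
  | .alpha => a
  | .beta => b
  | .low _ => lo
  | .mid _ => mi
  | .high _ => hi

/-- The first of four distinguished elements of a block. -/
def first (M l u : ℕ) : Block M l u :=
  ⟨tuple true true false false false, by constructor <;> simp [tuple]⟩

/-- The second of four distinguished elements of a block. -/
def second (M l u : ℕ) : Block M l u :=
  ⟨tuple false true false false true, by constructor <;> simp [tuple]⟩

/-- The third of four distinguished elements of a block. -/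
def third (M l u : ℕ) : Block M l u :=
  ⟨tuple false false false true true, by constructor <;> simp [tuple]⟩

/-- The last of four distinguished elements of a block. -/
def fourth (M l u : ℕ) : Block M l u :=
  ⟨tuple true false true true true, by constructor <;> simp [tuple]⟩

variable {M : ℕ}

/-- Below level `u` a `1` would climb to `mid (j + 1)`. At level `u` the bounds force `k = 0` and `M
= u + 2`, and then `top` applies; this is the only use of `beta`. -/
theorem IsAdmissible.high_eq_false {v : Coord → Bool} (hv : IsAdmissible M l u v) (hl : l ≤ 3)
    (hu : M ≤ u + 2) (ha : v .alpha = true) {k : ℕ} (hb : k = 0 → v .beta = true)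
    (hm : ∀ j, l ≤ j → j ≤ u → j + k < M → v (.mid j) = false) {j : ℕ} (h2 : 2 ≤ j) (hj : j ≤ u)
    (hk : j + k + 1 < M) : v (.high j) = false := by
  by_contra h
  rw [Bool.not_eq_false] at h
  rcases hj.lt_or_eq with hj | rfl
  · have h1 := hv.high_le j h2 hj h ha
    rw [hm (j + 1) (by omega) (by omega) (by omega)] at h1
    exact absurd h1 (by simp)
  · exact hv.top (by omega) ⟨h, hb (by omega), ha⟩

theorem IsAdmissible.mid_eq_false {v : Coord → Bool} (hv : IsAdmissible M l u v) {j : ℕ}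
    (hl : l ≤ j) (hu : j ≤ u) (hh : v (.high j) = false) : v (.mid j) = false := by
  by_contra h
  rw [hv.mid_le_high j hl hu (by simpa using h)] at hh
  exact absurd hh (by simp)

theorem IsAdmissible.low_eq_false {v : Coord → Bool} (hv : IsAdmissible M l u v) {j : ℕ}
    (hl : l ≤ j) (hu : j ≤ u) (hh : v (.mid j) = false) : v (.low j) = false := by
  by_contra h
  rw [hv.low_le_mid j hl hu (by simpa using h)] at hh
  exact absurd hh (by simp)

/-- The coordinates at which the first two and the last two distinguished elements agree. -/
def betaCoords : Set Coord := insert .beta (Set.range .mid)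

/-- One round: `β` keeps `mid`, the zeros of `mid (j + 1)` force zeros of `high j` as `alpha = 1`,
`γ` keeps `high`, and `mid j ≤ high j` returns to `mid` with one level fewer. -/
theorem seq_mid_eq_false (h2 : 2 ≤ l) (hl : l ≤ 3) (hu : M ≤ u + 2) {k : ℕ}
    {s : ℕ → Block M l u} (h0 : s 0 = first M l u)
    (hα : ∀ i ≤ k, agree {Coord.alpha} (first M l u) (s i))
    (hβ : ∀ i < k, Even i → agree betaCoords (s i) (s (i + 1)))
    (hγ : ∀ i < k, Odd i → agree (Set.range Coord.high) (s i) (s (i + 1))) (p : ℕ)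
    (hp : 2 * p ≤ k) {j : ℕ} (hlj : l ≤ j) (hju : j ≤ u) (hj : j + p < M) :
    (s (2 * p)).1 (.mid j) = false := by
  induction p generalizing j with
  | zero => rw [mul_zero, h0]; rfl
  | succ p ih =>
    have hβ' := hβ (2 * p) (by omega) ⟨p, by ring⟩
    have hγ' := hγ (2 * p + 1) (by omega) ⟨p, rfl⟩ (.high j) ⟨j, rfl⟩
    have hα' : (s (2 * p + 1)).1 .alpha = true := (hα (2 * p + 1) (by omega) .alpha rfl).symm
    refine (s (2 * (p + 1))).2.mid_eq_false hlj hju (hγ'.symm.trans ?_)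
    refine (s (2 * p + 1)).2.high_eq_false hl hu hα' (k := p) ?_ ?_ (h2.trans hlj) hju
      (by omega)
    · rintro rfl
      rw [← hβ' .beta (Set.mem_insert _ _), mul_zero, h0]
      rfl
    · intro i hli hiu hi
      rw [← hβ' (.mid i) (Set.mem_insert_of_mem _ ⟨i, rfl⟩)]
      exact ih (by omega) hli hiu hi

theorem agree_alpha_first_fourth : agree {Coord.alpha} (first M l u) (fourth M l u) := by
  rintro _ rfl; rfl

theorem agree_beta_first_second : agree betaCoords (first M l u) (second M l u) := by
  rintro _ (rfl | ⟨j, rfl⟩) <;> rfl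

theorem agree_high_second_fourth :
    agree (Set.range Coord.high) (second M l u) (fourth M l u) := by
  rintro _ ⟨j, rfl⟩; rfl

theorem agree_lowHigh_second_third :
    agree (Set.range Coord.low ∪ Set.range Coord.high) (second M l u) (third M l u) := by
  rintro _ (⟨j, rfl⟩ | ⟨j, rfl⟩) <;> rfl

theorem agree_alpha_second_third : agree {Coord.alpha} (second M l u) (third M l u) := by
  rintro _ rfl; rfl

theorem agree_beta_third_fourth : agree betaCoords (third M l u) (fourth M l u) := by
  rintro _ (rfl | ⟨j, rfl⟩) <;> rfl

end Block

/-! ### Integer levels: all thresholds on `n` places -/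

section Threshold

variable {n : ℕ}

/-- The generating operations of a variety of Baker's type. -/
def thresholdOps (n : ℕ) : Set ((Fin n → Bool) → Bool) :=
  {f | ∃ j, 2 ≤ j ∧ j + 1 ≤ n ∧ f = thresholdOp Finset.univ j}

/-- The generating operations, indexed by all natural numbers. -/
def thresholdFamily (n j : ℕ) : (Fin n → Bool) → Bool :=
  thresholdOp Finset.univ (if 2 ≤ j ∧ j + 1 ≤ n then j else 2)

theorem isThresholdFamily (hn : 3 ≤ n) :
    IsThresholdFamily Finset.univ 2 (n - 1) (thresholdFamily n) where
  two_le := le_rfl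
  le_three := by omega
  le_top := by omega
  lt j h2 hj x h := by
    rw [thresholdFamily, if_pos (by omega)] at h
    simpa [thresholdOp] using h
  eq_true j h2 hj x h := by
    rw [thresholdFamily, if_pos (by omega)]
    simpa [thresholdOp] using h

/-- Coordinates carry arbitrary natural levels, so those out of range also need an operation of the
variety; threshold `2` is the default. -/
theorem holdsFor_thresholdFamily (hn : 3 ≤ n) (j : ℕ)
    (e) (he : e ∈ (boolVariety (thresholdOps n)).identities) : HoldsFor (thresholdFamily n j) e := by
  refine mem_boolVariety_identities.1 he _ ⟨if 2 ≤ j ∧ j + 1 ≤ n then j else 2, ?_, ?_, rfl⟩ <;>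
    split_ifs <;> omega

theorem boolVariety_thresholdOps_hasNUTerm (hn : 3 ≤ n) :
    (boolVariety (thresholdOps n)).HasNUTerm n := by
  refine boolVariety_hasNUTerm hn ?_
  rintro f ⟨j, h2, hj, rfl⟩
  exact isNU_thresholdOp h2 hj

theorem boolVariety_thresholdOps_not_isDistributive (hn : 3 ≤ n) :
    ¬ (boolVariety (thresholdOps n)).IsDistributive (2 * n - 5) := by
  intro h
  have hF := isThresholdFamily hn
  let := blockStructure hF
  obtain ⟨s, h0, hk, hα, hβ, hγ⟩ := h.exists_seq (mem_block hF (holdsFor_thresholdFamily hn))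
    (isCongruence_agree hF _) (isCongruence_agree hF _) (isCongruence_agree hF _)
    agree_alpha_first_fourth agree_beta_first_second agree_high_second_fourth
  have h1 := seq_mid_eq_false le_rfl (by omega) (by simp; omega) h0 hα hβ hγ (n - 3)
    (by omega) le_rfl hF.le_top (by simp; omega)
  rw [hβ (2 * (n - 3)) (by omega) ⟨n - 3, by ring⟩ (.mid 2) (Set.mem_insert_of_mem _ ⟨2, rfl⟩),
    show 2 * (n - 3) + 1 = 2 * n - 5 by omega, hk] at h1
  exact absurd h1 (by simp [fourth, tuple])

/-- The `low` coordinates gain one step over the distributive case: `mid 2 = 0` forces `low 2 = 0`,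
and this survives one more `γ`-step. -/
theorem boolVariety_thresholdOps_not_isModular (hn : 3 ≤ n) :
    ¬ (boolVariety (thresholdOps n)).IsModular (2 * n - 4) := by
  intro h
  have hF := isThresholdFamily hn
  let := blockStructure hF
  obtain ⟨s, h0, hk, hα, hβ, hγ⟩ := h.exists_seq (mem_block hF (holdsFor_thresholdFamily hn))
    (isCongruence_agree hF _) (isCongruence_agree hF _) (isCongruence_agree hF _)
    agree_alpha_first_fourth agree_beta_first_second agree_lowHigh_second_third
    agree_alpha_second_third agree_beta_third_fourth
  have h1 := seq_mid_eq_false le_rfl (by omega) (by simp; omega) h0 hα hβ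
    (fun i hi ho κ hκ => hγ i hi ho κ (.inr hκ)) (n - 3)
    (by omega) le_rfl hF.le_top (by simp; omega)
  rw [hβ (2 * (n - 3)) (by omega) ⟨n - 3, by ring⟩ (.mid 2)
    (Set.mem_insert_of_mem _ ⟨2, rfl⟩)] at h1
  have h2 := (s (2 * (n - 3) + 1)).2.low_eq_false le_rfl hF.le_top h1
  rw [hγ (2 * (n - 3) + 1) (by omega) ⟨n - 3, by ring⟩ (.low 2) (.inl ⟨2, rfl⟩),
    show 2 * (n - 3) + 1 + 1 = 2 * n - 4 by omega, hk] at h2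
  exact absurd h2 (by simp [fourth, tuple])

end Threshold

/-! ### Half-integer levels: the variety `𝒩_{n½}` -/

section VarietyN

variable {n : ℕ}

/-- Operations in the variety `𝒩_{n½}`, up to complements the generating ones. -/
def halfFamily (n j : ℕ) : (Fin (n + 2) → Bool) → Bool :=
  if 3 ≤ j ∧ j + 1 ≤ n then thresholdOp (places n) j else booleanOp n

/-- The exact thresholds start at `3`, because `booleanOp` is not monotone in its second argument;
it still takes the value `1` only with at most one zero counted. -/
theorem isThresholdFamily_halfFamily (hn : 3 ≤ n) :
    IsThresholdFamily (places n) 3 (n - 1) (halfFamily n) where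
  two_le := by omega
  le_three := le_rfl
  le_top := by omega
  lt j h2 hj x h := by
    unfold halfFamily at h
    split_ifs at h with h3
    · simpa [thresholdOp] using h
    · have := (booleanOp_eq_true_iff.1 h).1
      omega
  eq_true j h2 hj x h := by
    rw [halfFamily, if_pos (by omega)]
    simpa [thresholdOp] using h

/-- Thresholds above `(n + 2) / 2` are not among the generators, but complementation carries them to
threshold `n + 2 - j`, which is. -/
theorem holdsFor_halfFamily (j : ℕ) (e) (he : e ∈ (varietyN n).identities) :
    HoldsFor (halfFamily n j) e := by
  rw [varietyN_eq] at he
  have he := mem_boolVariety_identities.1 he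
  unfold halfFamily
  split_ifs with hj
  · by_cases h : j ≤ (n + 2) / 2
    · exact he _ (.inr ⟨j, hj.1, h, latticeOp_eq.symm⟩)
    · refine (he _ (.inr ⟨n + 2 - j, by omega, by omega, latticeOp_eq.symm⟩)).of_not fun x => ?_
      exact thresholdOp_not (by rw [card_places]; omega)
  · exact he _ (.inl rfl)

theorem card_places_le (hn : 3 ≤ n) : (places n).card ≤ n - 1 + 2 := by
  rw [card_places]; omega

/-- Each factor `α(γ ∘ β)` costs one level: zeros of `high` pass along `γ`, down to `mid`, along
`β`, and back to `high` one level lower. -/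
theorem high_eq_false_of_relPow (hn : 3 ≤ n) {a b : Block (places n).card 3 (n - 1)} (k : ℕ)
    (h : relPow (⇑(agree {Coord.alpha}) ⊓
      Relation.Comp ⇑(agree (Set.range Coord.high)) ⇑(agree betaCoords)) k a b)
    (ha : a.1 .alpha = true)
    (hh : ∀ j, 2 ≤ j → j ≤ n - 1 → a.1 (.high j) = false) :
    b.1 .alpha = true ∧ ∀ j, 2 ≤ j → j ≤ n - 1 → j + k ≤ n - 1 → b.1 (.high j) = false := by
  induction k generalizing b with
  | zero => obtain rfl : a = b := h; exact ⟨ha, fun j h2 hj _ => hh j h2 hj⟩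
  | succ k ih =>
    obtain ⟨c, hc, hα, d, hγ, hβ⟩ := h
    obtain ⟨ih1, ih2⟩ := ih hc
    have hb : b.1 .alpha = true := (hα .alpha rfl).symm.trans ih1
    refine ⟨hb, fun j h2 hj hk => ?_⟩
    refine b.2.high_eq_false le_rfl (card_places_le hn) hb (k := k + 1) (by simp) ?_ h2 hj
      (by rw [card_places]; omega)
    intro i hi3 hiu hi
    rw [card_places] at hi
    rw [← hβ (.mid i) (Set.mem_insert_of_mem _ ⟨i, rfl⟩)]
    refine d.2.mid_eq_false hi3 hiu ?_
    rw [← hγ (.high i) ⟨i, rfl⟩]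
    exact ih2 i (by omega) hiu (by omega)

theorem varietyN_identity_fails (hn : 3 ≤ n) :
    ∃ (B : Type) (_ : (opLanguage (n + 2)).Structure B) (α β γ : Setoid B),
      (varietyN n).Mem B ∧
      IsCongruence (opLanguage (n + 2)) α ∧
      IsCongruence (opLanguage (n + 2)) β ∧
      IsCongruence (opLanguage (n + 2)) γ ∧
      ¬ (⇑α ⊓ Relation.Comp ⇑β ⇑γ ≤
          Relation.Comp (⇑α ⊓ ⇑β)
            (Relation.Comp (relPow (⇑α ⊓ Relation.Comp ⇑γ ⇑β) (n - 3)) (⇑α ⊓ ⇑γ))) := by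
  have hF := isThresholdFamily_halfFamily hn
  refine ⟨Block (places n).card 3 (n - 1), blockStructure hF, agree {Coord.alpha},
    agree betaCoords, agree (Set.range Coord.high), mem_block hF holdsFor_halfFamily,
    isCongruence_agree hF _, isCongruence_agree hF _, isCongruence_agree hF _, fun h => ?_⟩
  obtain ⟨a, ⟨hα, hβ⟩, b, hab, -, hγ⟩ := h (first _ _ _) (fourth _ _ _)
    ⟨agree_alpha_first_fourth, second _ _ _, agree_beta_first_second, agree_high_second_fourth⟩
  have ha : a.1 .alpha = true := (hα .alpha rfl).symm
  obtain ⟨-, h1⟩ := high_eq_false_of_relPow hn _ hab ha fun j h2 hj =>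
    a.2.high_eq_false le_rfl (card_places_le hn) ha (k := 0)
      (fun _ => (hβ .beta (Set.mem_insert _ _)).symm)
      (fun i _ _ _ => (hβ (.mid i) (Set.mem_insert_of_mem _ ⟨i, rfl⟩)).symm) h2 hj
      (by rw [card_places]; omega)
  have h2 := h1 2 le_rfl (by omega) (by omega)
  rw [hγ (.high 2) ⟨2, rfl⟩] at h2
  exact absurd h2 (by simp [fourth, tuple])

theorem relPow_of_seq {A : Type*} {R : A → A → Prop} (s : ℕ → A) (k : ℕ)
    (h : ∀ i < k, R (s i) (s (i + 1))) : relPow R k (s 0) (s k) := by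
  induction k with
  | zero => rfl
  | succ k ih => exact ⟨s k, ih fun i hi => h i (by omega), h k (by omega)⟩

/-- A chain of `2 * n - 4` steps, with its inner steps paired as `γ ∘ β`, would witness the identity
that fails. -/
theorem varietyN_not_isDistributive (hn : 3 ≤ n) :
    ¬ (varietyN n).IsDistributive (2 * n - 4) := by
  intro h
  obtain ⟨B, _, α, β, γ, hB, hα, hβ, hγ, hfail⟩ := varietyN_identity_fails hn
  refine hfail ?_
  rintro a c ⟨hac, b, hab, hbc⟩
  obtain ⟨s, h0, hk, sα, sβ, sγ⟩ := h.exists_seq hB hα hβ hγ hac hab hbc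
  refine ⟨s 1, ⟨sα 1 (by omega), h0 ▸ sβ 0 (by omega) ⟨0, rfl⟩⟩, s (2 * (n - 3) + 1), ?_, ?_, ?_⟩
  · refine relPow_of_seq (fun i => s (2 * i + 1)) (n - 3) fun i hi => ⟨?_, s (2 * i + 2), ?_, ?_⟩
    · exact α.trans (α.symm (sα _ (by omega))) (sα _ (by omega))
    · exact sγ _ (by omega) ⟨i, rfl⟩
    · exact sβ (2 * i + 2) (by omega) ⟨i + 1, by ring⟩
  · exact α.trans (α.symm (sα _ (by omega))) hac
  · have := sγ (2 * (n - 3) + 1) (by omega) ⟨n - 3, rfl⟩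
    rwa [show 2 * (n - 3) + 1 + 1 = 2 * n - 4 by omega, hk] at this

theorem varietyN_not_isModular (hn : 4 ≤ n) : ¬ (varietyN n).IsModular (2 * n - 3) := by
  intro h
  have hF := isThresholdFamily_halfFamily (n := n) (by omega)
  let := blockStructure hF
  obtain ⟨s, h0, hk, hα, hβ, hγ⟩ := h.exists_seq (mem_block hF holdsFor_halfFamily)
    (isCongruence_agree hF _) (isCongruence_agree hF _) (isCongruence_agree hF _)
    agree_alpha_first_fourth agree_beta_first_second agree_lowHigh_second_third
    agree_alpha_second_third agree_beta_third_fourth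
  -- The descent ends at level `3`, the lowest monotone one; `3 ≤ n - 1` is where `n ≥ 4` enters.
  have h1 := seq_mid_eq_false (by omega) le_rfl (card_places_le (by omega)) h0 hα hβ
    (fun i hi ho κ hκ => hγ i hi ho κ (.inr hκ)) (n - 3) (by omega) (j := 3) le_rfl (by omega)
    (by rw [card_places]; omega)
  rw [hβ (2 * (n - 3)) (by omega) ⟨n - 3, by ring⟩ (.mid 3)
    (Set.mem_insert_of_mem _ ⟨3, rfl⟩)] at h1
  have h2 := (s (2 * (n - 3) + 1)).2.low_eq_false le_rfl (by omega) h1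
  rw [hγ (2 * (n - 3) + 1) (by omega) ⟨n - 3, by ring⟩ (.low 3) (.inl ⟨3, rfl⟩)] at h2
  -- Level `2` is read backwards from `fourth` through the last `β`-step; `mid 2 ∧ alpha ≤ low 3`
  -- then contradicts `low 3 = 0`.
  have h3 : (s (2 * (n - 3) + 1 + 1)).1 (.mid 2) = true := by
    rw [hβ (2 * (n - 3) + 1 + 1) (by omega) ⟨n - 2, by omega⟩ (.mid 2)
      (Set.mem_insert_of_mem _ ⟨2, rfl⟩), show 2 * (n - 3) + 1 + 1 + 1 = 2 * n - 3 by omega, hk]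
    rfl
  have h4 := (s (2 * (n - 3) + 1 + 1)).2.mid_le 2 le_rfl (by omega) h3
    (hα _ (by omega) .alpha rfl).symm
  rw [h2] at h4
  exact absurd h4 (by simp)

theorem varietyN_locallyFinite : (varietyN n).LocallyFinite := by
  rw [varietyN_eq]
  exact boolVariety_locallyFinite

end VarietyN

/-! ### Strictness of the hierarchy -/

section Separation

variable {S : Set ExtraEqn}

theorem exists_not_isDistributive (S : Set ExtraEqn) {H : ℕ} (hH : 6 ≤ H) :
    ∃ (L : FirstOrder.Language.{0, 0}) (_ : L.IsAlgebraic) (V : Variety L),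
      V.LocallyFinite ∧ V.HasNU S H ∧ ¬ V.IsDistributive (H - 5) := by
  rcases Nat.even_or_odd' H with ⟨n, rfl | rfl⟩
  · exact ⟨_, inferInstance, _, boolVariety_locallyFinite,
      .inl ⟨n, rfl, boolVariety_thresholdOps_hasNUTerm (by omega)⟩,
      boolVariety_thresholdOps_not_isDistributive (by omega)⟩
  · exact ⟨_, inferInstance, _, varietyN_locallyFinite,
      .inr ⟨n, rfl, varietyN_hasHalfNUTerm (by omega) S⟩, varietyN_not_isDistributive (by omega)⟩

theorem exists_not_isModular (S : Set ExtraEqn) {H : ℕ} (hH : 8 ≤ H) :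
    ∃ (L : FirstOrder.Language.{0, 0}) (_ : L.IsAlgebraic) (V : Variety L),
      V.LocallyFinite ∧ V.HasNU S H ∧ ¬ V.IsModular (H - 4) := by
  rcases Nat.even_or_odd' H with ⟨n, rfl | rfl⟩
  · exact ⟨_, inferInstance, _, boolVariety_locallyFinite,
      .inl ⟨n, rfl, boolVariety_thresholdOps_hasNUTerm (by omega)⟩,
      boolVariety_thresholdOps_not_isModular (by omega)⟩
  · exact ⟨_, inferInstance, _, varietyN_locallyFinite,
      .inr ⟨n, rfl, varietyN_hasHalfNUTerm (by omega) S⟩, varietyN_not_isModular (by omega)⟩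

/-- The variety at level `K` that is not `(K - 5)`-distributive works: a term at level `H ≤ K - 1`
would give one at level `K - 1`, hence `(K - 5)`-distributivity. -/
theorem exists_not_hasNU (hS : S ⊆ {ExtraEqn.uu1, ExtraEqn.uu2, ExtraEqn.uu3}) {H K : ℕ}
    (hH : 6 ≤ H) (hHK : H < K) :
    ∃ (L : FirstOrder.Language.{0, 0}) (_ : L.IsAlgebraic) (V : Variety L),
      V.LocallyFinite ∧ V.HasNU S K ∧ ¬ V.HasNU S H := by
  obtain ⟨L, hL, V, h1, h2, h3⟩ := exists_not_isDistributive S (H := K) (by omega)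
  refine ⟨L, hL, V, h1, h2, fun h => h3 ?_⟩
  have := (h.mono hS (show H ≤ K - 1 by omega)).isDistributive (by omega)
  rwa [show K - 1 - 4 = K - 5 by omega] at this

theorem Variety.hasNU_two_mul {L : FirstOrder.Language} {V : Variety L} {n : ℕ} :
    V.HasNU S (2 * n) ↔ V.HasNUTerm n := by
  refine ⟨?_, fun h => .inl ⟨n, rfl, h⟩⟩
  rintro (⟨k, hk, h⟩ | ⟨k, hk, h⟩)
  · obtain rfl : k = n := by omega
    exact h
  · omega

theorem Variety.hasNU_two_mul_add_one {L : FirstOrder.Language} {V : Variety L} {n : ℕ} :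
    V.HasNU S (2 * n + 1) ↔ V.HasHalfNUTerm S n := by
  refine ⟨?_, fun h => .inr ⟨n, rfl, h⟩⟩
  rintro (⟨k, hk, h⟩ | ⟨k, hk, h⟩)
  · omega
  · obtain rfl : k = n := by omega
    exact h

end Separation

end NearUnanimity

theorem corollary6p3 :
    -- the statements about all half-integer levels, with any of (uu1)-(uu3) added;
    -- the levels are `h = H / 2` and `k = K / 2`, so `2h - 4` is `H - 4`, and so on
    (∀ S : Set ExtraEqn, S ⊆ {ExtraEqn.uu1, ExtraEqn.uu2, ExtraEqn.uu3} →
      (∀ H K : ℕ, 6 ≤ H → 6 ≤ K → H < K →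
        (∀ (L : FirstOrder.Language.{u, v}) [L.IsAlgebraic] (V : Variety L),
          V.HasNU S H → V.HasNU S K) ∧
        (∃ (L : FirstOrder.Language.{0, 0}) (_ : L.IsAlgebraic) (V : Variety L),
          V.LocallyFinite ∧ V.HasNU S K ∧ ¬ V.HasNU S H)) ∧
      (∀ H : ℕ, 6 ≤ H →
        (∀ (L : FirstOrder.Language.{u, v}) [L.IsAlgebraic] (V : Variety L),
          V.HasNU S H → V.IsDistributive (H - 4)) ∧
        (∃ (L : FirstOrder.Language.{0, 0}) (_ : L.IsAlgebraic) (V : Variety L),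
          V.LocallyFinite ∧ V.HasNU S H ∧ ¬ V.IsDistributive (H - 5))) ∧
      (∀ H : ℕ, 6 ≤ H →
        (∀ (L : FirstOrder.Language.{u, v}) [L.IsAlgebraic] (V : Variety L),
          V.HasNU S H → V.IsModular (H - 3)) ∧
        (8 ≤ H → ∃ (L : FirstOrder.Language.{0, 0}) (_ : L.IsAlgebraic) (V : Variety L),
          V.LocallyFinite ∧ V.HasNU S H ∧ ¬ V.IsModular (H - 4)))) ∧
    -- the comparison of `n`, `n½` and `n + 1`, with any of (uu1)-(uu3) added
    (∀ S : Set ExtraEqn, S ⊆ {ExtraEqn.uu1, ExtraEqn.uu2, ExtraEqn.uu3} → ∀ n : ℕ, 3 ≤ n →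
      (∀ (L : FirstOrder.Language.{u, v}) [L.IsAlgebraic] (V : Variety L),
        V.HasHalfNUTerm S n → V.HasNUTerm (n + 1)) ∧
      (∃ (L : FirstOrder.Language.{0, 0}) (_ : L.IsAlgebraic) (V : Variety L),
        V.LocallyFinite ∧ V.HasNUTerm (n + 1) ∧ ¬ V.HasHalfNUTerm S n) ∧
      (∀ (L : FirstOrder.Language.{u, v}) [L.IsAlgebraic] (V : Variety L),
        V.HasNUTerm n → V.HasHalfNUTerm S n) ∧
      (∃ (L : FirstOrder.Language.{0, 0}) (_ : L.IsAlgebraic) (V : Variety L),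
        V.LocallyFinite ∧ V.HasHalfNUTerm S n ∧ ¬ V.HasNUTerm n)) ∧
    -- the variety `𝒩_{n½}`, with any of (uu1)-(uu4) added
    (∀ S : Set ExtraEqn, ∀ n : ℕ, 3 ≤ n →
      (varietyN n).HasHalfNUTerm S n ∧
      ¬ (varietyN n).IsDistributive (2 * n - 4) ∧
      ∃ (B : Type) (_ : (opLanguage (n + 2)).Structure B) (α β γ : Setoid B),
        (varietyN n).Mem B ∧
        IsCongruence (opLanguage (n + 2)) α ∧
        IsCongruence (opLanguage (n + 2)) β ∧
        IsCongruence (opLanguage (n + 2)) γ ∧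
        ¬ (⇑α ⊓ Relation.Comp ⇑β ⇑γ ≤
            Relation.Comp (⇑α ⊓ ⇑β)
              (Relation.Comp (relPow (⇑α ⊓ Relation.Comp ⇑γ ⇑β) (n - 3)) (⇑α ⊓ ⇑γ)))) ∧
    -- symmetric near-unanimity terms
    (∀ (L : FirstOrder.Language.{u, v}) [L.IsAlgebraic] (V : Variety L) (n : ℕ),
      V.HasSymmetricNUTerm n → V.HasHalfNUTerm Set.univ n) := by
  refine ⟨fun S hS => ⟨fun H K hH _ hHK => ⟨fun L _ V h => h.mono hS hHK.le,
      exists_not_hasNU hS hH hHK⟩,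
      fun H hH => ⟨fun L _ V h => h.isDistributive hH, exists_not_isDistributive S hH⟩,
      fun H hH => ⟨fun L _ V h => h.isModular hH, exists_not_isModular S⟩⟩,
    fun S hS n hn => ⟨fun L _ V h => h.hasNUTerm, ?_, fun L _ V h => h.hasHalfNUTerm hS, ?_⟩,
    fun S n hn => ⟨varietyN_hasHalfNUTerm hn S, varietyN_not_isDistributive hn,
      varietyN_identity_fails hn⟩,
    fun L _ V n h => h.hasHalfNUTerm⟩
  · obtain ⟨L, hL, V, h1, h2, h3⟩ :=
      exists_not_hasNU hS (show 6 ≤ 2 * n + 1 by omega) (show _ < 2 * (n + 1) by omega)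
    exact ⟨L, hL, V, h1, Variety.hasNU_two_mul.1 h2, fun h => h3 (Variety.hasNU_two_mul_add_one.2 h)⟩
  · obtain ⟨L, hL, V, h1, h2, h3⟩ :=
      exists_not_hasNU hS (show 6 ≤ 2 * n by omega) (show _ < 2 * n + 1 by omega)
    exact ⟨L, hL, V, h1, Variety.hasNU_two_mul_add_one.1 h2, fun h => h3 (Variety.hasNU_two_mul.2 h)⟩
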